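/- **Existence of Unique Positive, Selfadjoint Extensions.** Let $\ell>0$ and let $\mathrm L^2=\mathrm L^2((0,\ell))$ be the complex Hilbert space with inner product $\langle\cdot,\cdot\rangle$ anti-linear in the first variable. Write $\xi^{(s)}\in\mathrm L^2$ for the distributional derivatives on $(0,\ell)$ and let $$\mathrm W^m=\{\xi\in\mathrm L^2:\ \xi^{(s)}\in\mathrm L^2\text{ for all }0\le s\le m\}.$$ If $\xi\in\mathrm W^m$ and $k<m$, then $\xi^{(k)}$ has a continuous representative on $[0,\ell]$, and $\xi^{(k)}(0)$, $\xi^{(k)}(\ell)$ denote its boundary values. Let $\delta_{++},\delta_{+-},\delta_{-+},\delta_{--}$ be the operators $\xi\mapsto\xi'$ in $\mathrm L^2$ whose domains are the closures, with respect to the norm $(\|\xi\|^2+\|\xi'\|^2)^{1/2}$ of $\mathrm W^1$, of the restrictions to $(0,\ell)$ of the functions in $C_c^\infty((0,\ell))$, $C_c^\infty((0,\infty))$, $C_c^\infty((-\infty,\ell))$, $C_c^\infty(\mathbb R)$, respectively. Products of operators have their natural domain, $\operatorname{dom}(BC)=\{\xi\in\operatorname{dom}(C): C\xi\in\operatorname{dom}(B)\}$.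 Consider the following nine beam supports, each with four boundary conditions (BV) and a product operator $\hat A$: - (a)–(a): $\xi(0)=\xi(\ell)=\xi''(0)=\xi''(\ell)=0$, $\ \hat A=\delta_{--}\delta_{++}\delta_{--}\delta_{++}$; - (a)–(b): $\xi(0)=\xi(\ell)=\xi'(\ell)=\xi''(0)=0$, $\ \hat A=\delta_{--}\delta_{+-}\delta_{-+}\delta_{++}$; - (a)–(c): $\xi(0)=\xi''(0)=\xi''(\ell)=\xi'''(\ell)=0$, $\ \hat A=\delta_{-+}\delta_{++}\delta_{--}\delta_{+-}$; - (b)–(b): $\xi(0)=\xi(\ell)=\xi'(0)=\xi'(\ell)=0$, $\ \hat A=\delta_{--}\delta_{--}\delta_{++}\delta_{++}$; - (b)–(c): $\xi(0)=\xi'(0)=\xi''(\ell)=\xi'''(\ell)=0$, $\ \hat A=\delta_{-+}\delta_{-+}\delta_{+-}\delta_{+-}$; - (c)–(c): $\xi''(0)=\xi''(\ell)=\xi'''(0)=\xi'''(\ell)=0$, $\ \hat A=\delta_{++}\delta_{++}\delta_{--}\delta_{--}$; - add-(i): $\xi'(0)=\xi'(\ell)=\xi'''(0)=\xi'''(\ell)=0$,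 $\ \hat A=\delta_{++}\delta_{--}\delta_{++}\delta_{--}$; - add-(ii): $\xi(0)=\xi'(\ell)=\xi''(0)=\xi'''(\ell)=0$, $\ \hat A=\delta_{-+}\delta_{+-}\delta_{-+}\delta_{+-}$; - add-(iii): $\xi(\ell)=\xi'(0)=\xi''(\ell)=\xi'''(0)=0$, $\ \hat A=\delta_{+-}\delta_{-+}\delta_{+-}\delta_{-+}$. An operator $A$ is called positive if $\langle\xi,A\xi\rangle\ge 0$ for all $\xi\in\operatorname{dom}(A)$. In each of these nine cases there exists a unique positive, selfadjoint operator $A$ in $\mathrm L^2$ that extends $\hat A$ (i.e. $\operatorname{dom}(\hat A)\subseteq\operatorname{dom}(A)$ and $A\xi=\hat A\xi$ on $\operatorname{dom}(\hat A)$) and satisfies $$\operatorname{dom}(A)\subseteq\{\xi\in\mathrm W^2:\ \xi\text{ fulfills those of the four BV that concern }\xi\text{ and }\xi'\}.$$ Moreover, for this unique $A$: 1. $\hat A$ is densely defined, symmetric and positive, and $A$ is its Friedrichs extension, that is, the selfadjoint operator associated with the closure of the form $\langle\xi,\hat A\eta\rangle$, $\xi,\eta\in\operatorname{dom}(\hat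 A)$; 2. $A=D^*D$, where $D$ is the product of the two factors of $\hat A$ that are applied first (for instance $D=\delta_{-+}\delta_{++}$ for (a)–(b)); 3. $A\xi=\xi''''$ for all $\xi\in\operatorname{dom}(A)\cap\mathrm W^4$; 4. $\operatorname{dom}(A)\cap\mathrm W^4=\{\xi\in\mathrm W^4:\ \xi\text{ fulfills all four BV}\}=\operatorname{dom}(\hat A)$. -/

import Mathlib

open MeasureTheory Set Filter Topology
open scoped ContDiff ComplexConjugate

noncomputable section

namespace Beam

/-! ### The Hilbert space, distributional derivatives, Sobolev spaces -/

/-- The complex Hilbert space `L²((0,ℓ))`; its inner product is anti-linear in the first variable. -/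
abbrev L2 (ℓ : ℝ) : Type := Lp ℂ 2 (volume.restrict (Ioo (0 : ℝ) ℓ))

/-- `φ` belongs to `C_c^∞(I)`, extended by zero to the real line. -/
structure IsTestFun (I : Set ℝ) (φ : ℝ → ℂ) : Prop where
  smooth : ContDiff ℝ ∞ φ
  compactSupport : HasCompactSupport φ
  support_subset : tsupport φ ⊆ I

/-- `η` is the square integrable `s`-th derivative of `ξ` in the distributional sense:
`⟨η, φ⟩ = (-1)^s ⟨ξ, φ^(s)⟩` for all test functions `φ` on `(0,ℓ)`. -/
def IsWeakDeriv (ℓ : ℝ) (s : ℕ) (ξ η : L2 ℓ) : Prop :=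
  ∀ φ : ℝ → ℂ, IsTestFun (Ioo 0 ℓ) φ →
    ∫ x in Ioo 0 ℓ, conj (η x) * φ x =
      (-1) ^ s * ∫ x in Ioo 0 ℓ, conj (ξ x) * iteratedDeriv s φ x

theorem IsTestFun.iteratedDeriv_continuous {I : Set ℝ} {φ : ℝ → ℂ} (h : IsTestFun I φ) (s : ℕ) :
    Continuous (iteratedDeriv s φ) :=
  h.smooth.continuous_iteratedDeriv s (by exact_mod_cast le_top)

theorem integrable_conj_mul (ℓ : ℝ) (ξ : L2 ℓ) {g : ℝ → ℂ} (hg : Continuous g) :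
    Integrable (fun x => conj (ξ x) * g x) (volume.restrict (Ioo 0 ℓ)) := by
  have h1 : Integrable (fun x => conj (ξ x)) (volume.restrict (Ioo 0 ℓ)) := by
    have h2 : MemLp (fun x => star (ξ x)) 2 (volume.restrict (Ioo 0 ℓ)) := (Lp.memLp ξ).star
    exact h2.integrable (by norm_num)
  obtain ⟨C, hC⟩ := (isCompact_Icc (a := (0 : ℝ)) (b := ℓ)).exists_bound_of_continuousOn
    hg.continuousOn
  refine h1.mul_bdd (c := C) hg.aestronglyMeasurable ?_
  filter_upwards [ae_restrict_mem measurableSet_Ioo] with x hx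
  exact hC x (Ioo_subset_Icc_self hx)

theorem integral_add_conj (ℓ : ℝ) (ξ η : L2 ℓ) {g : ℝ → ℂ} (hg : Continuous g) :
    ∫ x in Ioo 0 ℓ, conj ((ξ + η : L2 ℓ) x) * g x =
      (∫ x in Ioo 0 ℓ, conj (ξ x) * g x) + ∫ x in Ioo 0 ℓ, conj (η x) * g x := by
  rw [← integral_add (integrable_conj_mul ℓ ξ hg) (integrable_conj_mul ℓ η hg)]
  refine integral_congr_ae ?_
  filter_upwards [Lp.coeFn_add ξ η] with x hx
  rw [hx, Pi.add_apply, map_add, add_mul]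

theorem integral_smul_conj (ℓ : ℝ) (c : ℂ) (ξ : L2 ℓ) (g : ℝ → ℂ) :
    ∫ x in Ioo 0 ℓ, conj ((c • ξ : L2 ℓ) x) * g x =
      conj c * ∫ x in Ioo 0 ℓ, conj (ξ x) * g x := by
  rw [← integral_const_mul]
  refine integral_congr_ae ?_
  filter_upwards [Lp.coeFn_smul c ξ] with x hx
  rw [hx, Pi.smul_apply, smul_eq_mul, map_mul, mul_assoc]

theorem IsWeakDeriv.add {ℓ : ℝ} {s : ℕ} {ξ₁ η₁ ξ₂ η₂ : L2 ℓ} (h₁ : IsWeakDeriv ℓ s ξ₁ η₁)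
    (h₂ : IsWeakDeriv ℓ s ξ₂ η₂) : IsWeakDeriv ℓ s (ξ₁ + ξ₂) (η₁ + η₂) := by
  intro φ hφ
  rw [integral_add_conj ℓ _ _ hφ.smooth.continuous,
    integral_add_conj ℓ _ _ (hφ.iteratedDeriv_continuous s), h₁ φ hφ, h₂ φ hφ, mul_add]

theorem IsWeakDeriv.smul {ℓ : ℝ} {s : ℕ} {ξ η : L2 ℓ} (c : ℂ) (h : IsWeakDeriv ℓ s ξ η) :
    IsWeakDeriv ℓ s (c • ξ) (c • η) := by
  intro φ hφ
  rw [integral_smul_conj, integral_smul_conj, h φ hφ]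
  ring

theorem IsWeakDeriv.zero (ℓ : ℝ) (s : ℕ) : IsWeakDeriv ℓ s 0 0 := by
  have h : ∀ g : ℝ → ℂ, ∫ x in Ioo 0 ℓ, conj ((0 : L2 ℓ) x) * g x = 0 := by
    intro g
    have := integral_smul_conj ℓ 0 (0 : L2 ℓ) g
    simpa using this
  intro φ _
  rw [h, h, mul_zero]

theorem eq_zero_of_isWeakDeriv_zero {ℓ : ℝ} {s : ℕ} {η : L2 ℓ} (h : IsWeakDeriv ℓ s 0 η) :
    η = 0 := by
  have h0 : ∀ φ : ℝ → ℂ, IsTestFun (Ioo 0 ℓ) φ →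
      ∫ x in Ioo 0 ℓ, conj (η x) * φ x = 0 := by
    intro φ hφ
    have hz : ∫ x in Ioo 0 ℓ, conj ((0 : L2 ℓ) x) * iteratedDeriv s φ x = 0 := by
      have := integral_smul_conj ℓ 0 (0 : L2 ℓ) (iteratedDeriv s φ)
      simpa using this
    rw [h φ hφ, hz, mul_zero]
  have hmem : MemLp (fun x => star (η x)) 2 (volume.restrict (Ioo 0 ℓ)) := (Lp.memLp η).star
  have hint : IntegrableOn (fun x => conj (η x)) (Ioo 0 ℓ) volume :=
    hmem.integrable (by norm_num)
  have key := isOpen_Ioo.ae_eq_zero_of_integral_contDiff_smul_eq_zero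
    (hint.locallyIntegrableOn) (fun g hg hgc hgs => by
      have hT : IsTestFun (Ioo 0 ℓ) (fun x => (g x : ℂ)) :=
        { smooth := Complex.ofRealCLM.contDiff.comp hg
          compactSupport := hgc.comp_left (g := fun r : ℝ => (r : ℂ)) (by simp)
          support_subset := (tsupport_comp_subset (g := fun r : ℝ => (r : ℂ)) (by simp) g).trans
            hgs }
      have h1 := h0 _ hT
      rw [← setIntegral_eq_integral_of_forall_compl_eq_zero (s := Ioo 0 ℓ)]
      · rw [← h1]
        refine integral_congr_ae (Eventually.of_forall fun x => ?_)
        simp [mul_comm]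
      · intro x hx
        have : g x = 0 := by
          by_contra hne
          exact hx (hgs (subset_tsupport g hne))
        simp [this])
  refine (Lp.eq_zero_iff_ae_eq_zero).2 ?_
  rw [EventuallyEq, ae_restrict_iff' measurableSet_Ioo]
  filter_upwards [key] with x hx hxI
  have := hx hxI
  simpa using this

/-- The Sobolev space `W^m((0,ℓ))`, as a subspace of `L²((0,ℓ))`. -/
def sobolev (ℓ : ℝ) (m : ℕ) : Submodule ℂ (L2 ℓ) where
  carrier := {ξ | ∀ s ≤ m, ∃ η, IsWeakDeriv ℓ s ξ η}
  zero_mem' := fun s _ => ⟨0, IsWeakDeriv.zero ℓ s⟩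
  add_mem' := fun h₁ h₂ s hs => by
    obtain ⟨η₁, h₁⟩ := h₁ s hs
    obtain ⟨η₂, h₂⟩ := h₂ s hs
    exact ⟨η₁ + η₂, h₁.add h₂⟩
  smul_mem' := fun c _ h s hs => by
    obtain ⟨η, h⟩ := h s hs
    exact ⟨c • η, h.smul c⟩

/-! ### The four first-order operators and operator products -/

/-- All pairs `(ξ, ξ')` with `ξ ∈ W¹`. -/
def weakDerivGraph (ℓ : ℝ) : Submodule ℂ (L2 ℓ × L2 ℓ) where
  carrier := {p | IsWeakDeriv ℓ 1 p.1 p.2}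
  zero_mem' := IsWeakDeriv.zero ℓ 1
  add_mem' := fun h₁ h₂ => IsWeakDeriv.add h₁ h₂
  smul_mem' := fun c _ h => IsWeakDeriv.smul c h

/-- Distributional differentiation `ξ ↦ ξ'` with domain `W¹`. -/
def weakDeriv (ℓ : ℝ) : L2 ℓ →ₗ.[ℂ] L2 ℓ := (weakDerivGraph ℓ).toLinearPMap

theorem weakDeriv_graph (ℓ : ℝ) : (weakDeriv ℓ).graph = weakDerivGraph ℓ := by
  refine Submodule.toLinearPMap_graph_eq _ ?_
  rintro ⟨ξ, η⟩ h h0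
  have h0' : ξ = 0 := h0
  subst h0'
  exact eq_zero_of_isWeakDeriv_zero (s := 1) h

theorem weakDeriv_domain (ℓ : ℝ) : (weakDeriv ℓ).domain = sobolev ℓ 1 := by
  ext ξ
  rw [LinearPMap.mem_domain_iff, weakDeriv_graph]
  constructor
  · rintro ⟨η, h⟩ s hs
    interval_cases s
    · exact ⟨ξ, fun φ _ => by simp⟩
    · exact ⟨η, h⟩
  · intro h
    exact h 1 le_rfl

/-- All pairs `(φ|_(0,ℓ), φ'|_(0,ℓ))` with `φ ∈ C_c^∞(I)`. -/
def testGraph (ℓ : ℝ) (I : Set ℝ) : Submodule ℂ (L2 ℓ × L2 ℓ) where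
  carrier := {p | ∃ φ : ℝ → ℂ, IsTestFun I φ ∧
    p.1 =ᵐ[volume.restrict (Ioo 0 ℓ)] φ ∧ p.2 =ᵐ[volume.restrict (Ioo 0 ℓ)] deriv φ}
  zero_mem' := by
    refine ⟨0, ⟨contDiff_const, HasCompactSupport.zero, by simp [tsupport]⟩, ?_, ?_⟩
    · exact Lp.coeFn_zero ℂ 2 _
    · have : deriv (0 : ℝ → ℂ) = 0 := by ext x; simp
      rw [this]
      exact Lp.coeFn_zero ℂ 2 _
  add_mem' := by
    rintro p q ⟨φ, hφ, hp₁, hp₂⟩ ⟨ψ, hψ, hq₁, hq₂⟩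
    refine ⟨φ + ψ, ⟨hφ.smooth.add hψ.smooth, hφ.compactSupport.add hψ.compactSupport,
      (tsupport_add φ ψ).trans (union_subset hφ.support_subset hψ.support_subset)⟩, ?_, ?_⟩
    · filter_upwards [Lp.coeFn_add p.1 q.1, hp₁, hq₁] with x h h₁ h₂
      rw [Prod.fst_add, h, Pi.add_apply, h₁, h₂, Pi.add_apply]
    · filter_upwards [Lp.coeFn_add p.2 q.2, hp₂, hq₂] with x h h₁ h₂
      rw [Prod.snd_add, h, Pi.add_apply, h₁, h₂,
        deriv_add (hφ.smooth.differentiable (by simp) x) (hψ.smooth.differentiable (by simp) x)]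
  smul_mem' := by
    rintro c p ⟨φ, hφ, hp₁, hp₂⟩
    refine ⟨c • φ, ⟨hφ.smooth.const_smul c, hφ.compactSupport.smul_left (f := fun _ => c),
      (tsupport_smul_subset_right (fun _ => c) φ).trans hφ.support_subset⟩, ?_, ?_⟩
    · filter_upwards [Lp.coeFn_smul c p.1, hp₁] with x h h₁
      rw [Prod.smul_fst, h, Pi.smul_apply, h₁, Pi.smul_apply]
    · filter_upwards [Lp.coeFn_smul c p.2, hp₂] with x h h₁
      rw [Prod.smul_snd, h, Pi.smul_apply, h₁,
        deriv_const_smul c (hφ.smooth.differentiable (by simp) x)]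

/-- The index of a first-order operator at one end of the interval: `plus` means that the
boundary condition `ξ = 0` is imposed at that end, `minus` means that it is not. -/
inductive Sgn
  | plus
  | minus

/-- The open interval `(0,ℓ)`, `(0,∞)`, `(-∞,ℓ)` or `ℝ` belonging to the signs `++`, `+-`, `-+`,
`--` (left end first). -/
def testInterval (ℓ : ℝ) : Sgn → Sgn → Set ℝ
  | .plus, .plus => Ioo 0 ℓ
  | .plus, .minus => Ioi 0
  | .minus, .plus => Iio ℓ
  | .minus, .minus => univ

/-- The domain of `δ_{ab}`: the closure of `C_c^∞(I)|_(0,ℓ)` in `W¹` for the first Sobolev norm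
`(‖ξ‖² + ‖ξ'‖²)^{1/2}`. This norm is equivalent to the norm of the pair `(ξ, ξ')` in `L² × L²`. -/
def deltaDomain (ℓ : ℝ) (a b : Sgn) : Submodule ℂ (L2 ℓ) :=
  ((weakDeriv ℓ).graph ⊓ (testGraph ℓ (testInterval ℓ a b)).topologicalClosure).map
    (LinearMap.fst ℂ (L2 ℓ) (L2 ℓ))

/-- The first-order operators `δ_{++}`, `δ_{+-}`, `δ_{-+}`, `δ_{--}`, all acting as `ξ ↦ ξ'`. -/
def delta (ℓ : ℝ) (a b : Sgn) : L2 ℓ →ₗ.[ℂ] L2 ℓ :=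
  (weakDeriv ℓ).domRestrict (deltaDomain ℓ a b)

/-- The product `BC` of two operators: `dom (BC) = {ξ ∈ dom C | Cξ ∈ dom B}`, `(BC)ξ = B(Cξ)`. -/
def opMul {ℓ : ℝ} (B C : L2 ℓ →ₗ.[ℂ] L2 ℓ) : L2 ℓ →ₗ.[ℂ] L2 ℓ :=
  B.comp (C.domRestrict ((B.domain.comap C.toFun).map C.domain.subtype)) (by
    rintro ⟨x, ⟨⟨y, hy, hyx⟩, hx⟩⟩
    have hyx' : y = ⟨x, hx⟩ := Subtype.ext hyx
    subst hyx'
    have h : (C.domRestrict ((B.domain.comap C.toFun).map C.domain.subtype))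
        ⟨x, ⟨⟨⟨x, hx⟩, hy, hyx⟩, hx⟩⟩ = C ⟨x, hx⟩ := LinearPMap.domRestrict_apply rfl
    rw [h]
    exact hy)

theorem mem_opMul_graph {ℓ : ℝ} (B C : L2 ℓ →ₗ.[ℂ] L2 ℓ) (ξ ζ : L2 ℓ) :
    (ξ, ζ) ∈ (opMul B C).graph ↔ ∃ η, (ξ, η) ∈ C.graph ∧ (η, ζ) ∈ B.graph := by
  have hres : ∀ (x : L2 ℓ) (hx : x ∈ (opMul B C).domain),
      (C.domRestrict ((B.domain.comap C.toFun).map C.domain.subtype)) ⟨x, hx⟩ = C ⟨x, hx.2⟩ :=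
    fun x hx => LinearPMap.domRestrict_apply rfl
  have happ : ∀ (x : L2 ℓ) (hx : x ∈ (opMul B C).domain) (h : C ⟨x, hx.2⟩ ∈ B.domain),
      opMul B C ⟨x, hx⟩ = B ⟨C ⟨x, hx.2⟩, h⟩ := by
    intro x hx h
    have : (opMul B C) ⟨x, hx⟩ = B ⟨(C.domRestrict
      ((B.domain.comap C.toFun).map C.domain.subtype)) ⟨x, hx⟩, by rw [hres]; exact h⟩ := rfl
    rw [this]
    congr 1
  constructor
  · intro h
    obtain ⟨⟨x, hx⟩, hx1, hx2⟩ := (LinearPMap.mem_graph_iff _).1 h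
    have hx1' : x = ξ := hx1
    subst hx1'
    have hB : C ⟨x, hx.2⟩ ∈ B.domain := by
      obtain ⟨y, hy, hyx⟩ := hx.1
      have : y = ⟨x, hx.2⟩ := Subtype.ext hyx
      rw [← this]
      exact hy
    refine ⟨C ⟨x, hx.2⟩, LinearPMap.mem_graph C ⟨x, hx.2⟩, ?_⟩
    have hx2' : opMul B C ⟨x, hx⟩ = ζ := hx2
    exact (LinearPMap.mem_graph_iff _).2 ⟨⟨_, hB⟩, rfl, (happ x hx hB).symm.trans hx2'⟩
  · rintro ⟨η, hC, hB⟩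
    obtain ⟨x, hx1, hx2⟩ := (LinearPMap.mem_graph_iff _).1 hC
    obtain ⟨y, hy1, hy2⟩ := (LinearPMap.mem_graph_iff _).1 hB
    simp only at hx1 hx2 hy1 hy2
    subst hx1 hx2
    have hB' : C x ∈ B.domain := hy1 ▸ y.2
    have hdom : (x : L2 ℓ) ∈ (opMul B C).domain := ⟨⟨x, hB', rfl⟩, x.2⟩
    refine (LinearPMap.mem_graph_iff _).2 ⟨⟨x, hdom⟩, rfl, ?_⟩
    rw [← hy2]
    show opMul B C ⟨x, hdom⟩ = B y
    rw [happ x hdom hB']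
    congr 1
    exact Subtype.ext hy1.symm

/-! ### Boundary values and the nine beam supports -/

/-- The two ends `x = 0` and `x = ℓ` of the beam. -/
inductive End
  | left
  | right

/-- The position of an end. -/
def End.pos (ℓ : ℝ) : End → ℝ
  | .left => 0
  | .right => ℓ

/-- The boundary condition `ξ^(k)(x⋆) = 0` at an end `x⋆`: the distributional derivative `ξ^(k)`
exists in `L²`, has a representative that is continuous on `[0,ℓ]`, and this one vanishes at `x⋆`.
-/
def VanishesAt (ℓ : ℝ) (k : ℕ) (e : End) (ξ : L2 ℓ) : Prop :=
  ∃ η : L2 ℓ, IsWeakDeriv ℓ k ξ η ∧ ∃ g : ℝ → ℂ, ContinuousOn g (Icc 0 ℓ) ∧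
    η =ᵐ[volume.restrict (Ioo 0 ℓ)] g ∧ g (e.pos ℓ) = 0

/-- The nine beam supports: `aa` is (a)--(a), `ab` is (a)--(b), and so on, `add1`, `add2`, `add3`
are the three additional cases. -/
inductive Support
  | aa | ab | ac | bb | bc | cc | add1 | add2 | add3

/-- The four boundary conditions of a support; `(k, e)` stands for `ξ^(k) = 0` at the end `e`. -/
def Support.bv : Support → List (ℕ × End)
  | .aa => [(0, .left), (0, .right), (2, .left), (2, .right)]
  | .ab => [(0, .left), (0, .right), (1, .right), (2, .left)]
  | .ac => [(0, .left), (2, .left), (2, .right), (3, .right)]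
  | .bb => [(0, .left), (0, .right), (1, .left), (1, .right)]
  | .bc => [(0, .left), (1, .left), (2, .right), (3, .right)]
  | .cc => [(2, .left), (2, .right), (3, .left), (3, .right)]
  | .add1 => [(1, .left), (1, .right), (3, .left), (3, .right)]
  | .add2 => [(0, .left), (1, .right), (2, .left), (3, .right)]
  | .add3 => [(0, .right), (1, .left), (2, .right), (3, .left)]

/-- `ξ` fulfills all four boundary conditions of the support. -/
def FulfillsAllBV (ℓ : ℝ) (S : Support) (ξ : L2 ℓ) : Prop :=
  ∀ p ∈ S.bv, VanishesAt ℓ p.1 p.2 ξ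

/-- `ξ` fulfills those boundary conditions of the support that concern `ξ` and `ξ'`. -/
def FulfillsLowBV (ℓ : ℝ) (S : Support) (ξ : L2 ℓ) : Prop :=
  ∀ p ∈ S.bv, p.1 ≤ 1 → VanishesAt ℓ p.1 p.2 ξ

/-- The right half `δδ` (the two factors that are applied first) of the product operator. -/
def innerOp (ℓ : ℝ) : Support → (L2 ℓ →ₗ.[ℂ] L2 ℓ)
  | .aa => opMul (delta ℓ .minus .minus) (delta ℓ .plus .plus)
  | .ab => opMul (delta ℓ .minus .plus) (delta ℓ .plus .plus)
  | .ac => opMul (delta ℓ .minus .minus) (delta ℓ .plus .minus)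
  | .bb => opMul (delta ℓ .plus .plus) (delta ℓ .plus .plus)
  | .bc => opMul (delta ℓ .plus .minus) (delta ℓ .plus .minus)
  | .cc => opMul (delta ℓ .minus .minus) (delta ℓ .minus .minus)
  | .add1 => opMul (delta ℓ .plus .plus) (delta ℓ .minus .minus)
  | .add2 => opMul (delta ℓ .minus .plus) (delta ℓ .plus .minus)
  | .add3 => opMul (delta ℓ .plus .minus) (delta ℓ .minus .plus)

/-- The left half `δδ` of the product operator. -/
def outerOp (ℓ : ℝ) : Support → (L2 ℓ →ₗ.[ℂ] L2 ℓ)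
  | .aa => opMul (delta ℓ .minus .minus) (delta ℓ .plus .plus)
  | .ab => opMul (delta ℓ .minus .minus) (delta ℓ .plus .minus)
  | .ac => opMul (delta ℓ .minus .plus) (delta ℓ .plus .plus)
  | .bb => opMul (delta ℓ .minus .minus) (delta ℓ .minus .minus)
  | .bc => opMul (delta ℓ .minus .plus) (delta ℓ .minus .plus)
  | .cc => opMul (delta ℓ .plus .plus) (delta ℓ .plus .plus)
  | .add1 => opMul (delta ℓ .plus .plus) (delta ℓ .minus .minus)
  | .add2 => opMul (delta ℓ .minus .plus) (delta ℓ .plus .minus)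
  | .add3 => opMul (delta ℓ .plus .minus) (delta ℓ .minus .plus)

/-- The fourth-order product operator `Â = δ δ δ δ` of a support. -/
def productOp (ℓ : ℝ) (S : Support) : L2 ℓ →ₗ.[ℂ] L2 ℓ :=
  opMul (outerOp ℓ S) (innerOp ℓ S)

/-! ### Positive operators and the Friedrichs extension -/

/-- `⟨ξ, Aξ⟩` is a nonnegative real number for every `ξ ∈ dom A`. -/
def IsPositiveOp {ℓ : ℝ} (A : L2 ℓ →ₗ.[ℂ] L2 ℓ) : Prop :=
  ∀ ξ : A.domain, 0 ≤ (inner ℂ (ξ : L2 ℓ) (A ξ)).re ∧ (inner ℂ (ξ : L2 ℓ) (A ξ)).im = 0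

/-- The sequence `u` in `dom T` converges to `ξ` in the sense of the form
`t(ξ, η) = ⟨ξ, Tη⟩`: `u n → ξ` in `L²` and `t(u n - u m, u n - u m) → 0` as `n, m → ∞`. -/
def FormConverges {ℓ : ℝ} (T : L2 ℓ →ₗ.[ℂ] L2 ℓ) (u : ℕ → T.domain) (ξ : L2 ℓ) : Prop :=
  Tendsto (fun n => (u n : L2 ℓ)) atTop (𝓝 ξ) ∧
    Tendsto (fun p : ℕ × ℕ => inner ℂ ((u p.1 - u p.2 : T.domain) : L2 ℓ) (T (u p.1 - u p.2)))
      atTop (𝓝 0)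

/-- The domain of the closure of the form `t(ξ, η) = ⟨ξ, Tη⟩`, `ξ, η ∈ dom T`. -/
def formClosureDomain {ℓ : ℝ} (T : L2 ℓ →ₗ.[ℂ] L2 ℓ) : Set (L2 ℓ) :=
  {ξ | ∃ u, FormConverges T u ξ}

/-- The closure of the form `t(ξ, η) = ⟨ξ, Tη⟩` takes the value `c` at `(ξ, η)`. -/
def FormClosureValue {ℓ : ℝ} (T : L2 ℓ →ₗ.[ℂ] L2 ℓ) (ξ η : L2 ℓ) (c : ℂ) : Prop :=
  ∃ u v, FormConverges T u ξ ∧ FormConverges T v η ∧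
    Tendsto (fun n => inner ℂ (u n : L2 ℓ) (T (v n))) atTop (𝓝 c)

/-- `A` is the Friedrichs extension of the densely defined, symmetric, positive operator `T`: the
operator associated with the closure `t` of the form `⟨ξ, Tη⟩`, that is, `η ∈ dom A` with
`Aη = φ` if and only if `η ∈ dom t` and `t(ξ, η) = ⟨ξ, φ⟩` for all `ξ ∈ dom t`. -/
structure IsFriedrichsExtension {ℓ : ℝ} (T A : L2 ℓ →ₗ.[ℂ] L2 ℓ) : Prop where
  dense : Dense (T.domain : Set (L2 ℓ))
  symmetric : T.IsFormalAdjoint T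
  positive : IsPositiveOp T
  graph_iff : ∀ η φ : L2 ℓ, (η, φ) ∈ A.graph ↔
    η ∈ formClosureDomain T ∧
      ∀ ξ ∈ formClosureDomain T, FormClosureValue T ξ η (inner ℂ ξ φ)

/-- `A` is a positive, selfadjoint extension of `Â` whose domain lies in the set of all `ξ ∈ W²`
that fulfill the boundary conditions on `ξ` and `ξ'`. -/
structure IsAdmissibleExtension (ℓ : ℝ) (S : Support) (A : L2 ℓ →ₗ.[ℂ] L2 ℓ) : Prop where
  selfAdjoint : IsSelfAdjoint A
  positive : IsPositiveOp A
  extends_product : productOp ℓ S ≤ A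
  domain_subset : ∀ ξ ∈ A.domain, ξ ∈ sobolev ℓ 2 ∧ FulfillsLowBV ℓ S ξ

end Beam

end

noncomputable section

namespace Beam

/-! ### Absolutely continuous complex-valued functions -/

/-! The product `Â` is already selfadjoint, so `A = Â`. Write `D` for its right half. Integration by
parts makes `-δ_{ab}` and the operator with complementary signs mutually adjoint, and the signs in
each of the nine cases are arranged so that the left half of `Â` is exactly `D†` (`innerOp_adjoint`,
resting on `opMul_delta_adjoint`). Hence `Â = D†D` with `D` closed and densely defined, which is
positive and, by von Neumann's theorem, selfadjoint (`isSelfAdjoint_of_graph`). Uniqueness follows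
because a selfadjoint operator has no proper selfadjoint extension (`eq_of_isSelfAdjoint_of_le`).

The domain of `D†D` is a core of `D`, so the closure of the form of `Â` is `⟨Dξ, Dη⟩` on `dom D`;
its associated operator is again `D†D` (`isFriedrichsExtension_self`).

The concrete input is `mem_closure_testGraph_iff`: the domain of `δ_{ab}`, defined as a closure of
test functions, consists of the absolutely continuous functions with derivative in `L²` and zero
boundary value at each `plus` end. Reading the four factors of `Â` one after another then yields
`W⁴` with all four boundary conditions (`mem_productOp_graph_iff`). -/

theorem _root_.AbsolutelyContinuousOnInterval.ofReal {f : ℝ → ℝ} {a b : ℝ}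
    (hf : AbsolutelyContinuousOnInterval f a b) :
    AbsolutelyContinuousOnInterval (fun x => (f x : ℂ)) a b := by
  have h1 : AbsolutelyContinuousOnInterval (fun _ : ℝ => (1 : ℂ)) a b :=
    (contDiff_const.contDiffOn).absolutelyContinuousOnInterval
  simpa using hf.fun_smul h1

theorem absolutelyContinuousOnInterval_integral {f : ℝ → ℂ} {a b : ℝ}
    (hf : IntervalIntegrable f volume a b) :
    AbsolutelyContinuousOnInterval (fun x => ∫ t in a..x, f t) a b := by
  have hre : IntervalIntegrable (fun x => (f x).re) volume a b :=
    ⟨hf.1.re, hf.2.re⟩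
  have him : IntervalIntegrable (fun x => (f x).im) volume a b :=
    ⟨hf.1.im, hf.2.im⟩
  have h1 := (hre.absolutelyContinuousOnInterval_intervalIntegral left_mem_uIcc).ofReal
  have h2 := (him.absolutelyContinuousOnInterval_intervalIntegral left_mem_uIcc).ofReal
  have h3 := h1.fun_add (h2.const_smul Complex.I)
  have hEq : ∀ x ∈ uIcc a b, ∫ t in a..x, f t =
      ((∫ t in a..x, (f t).re : ℝ) : ℂ) + Complex.I • ((∫ t in a..x, (f t).im : ℝ) : ℂ) := by
    intro x hx
    have hs : uIcc a x ⊆ uIcc a b := uIcc_subset_uIcc left_mem_uIcc hx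
    rw [← intervalIntegral.integral_ofReal, ← intervalIntegral.integral_ofReal,
      ← intervalIntegral.integral_smul, ← intervalIntegral.integral_add]
    · refine intervalIntegral.integral_congr fun t _ => ?_
      simp only [smul_eq_mul]
      rw [mul_comm]
      exact (Complex.re_add_im (f t)).symm
    · exact ⟨(hre.mono_set hs).1.ofReal, (hre.mono_set hs).2.ofReal⟩
    · have him' : IntervalIntegrable (fun x => ((f x).im : ℂ)) volume a x :=
        ⟨(him.mono_set hs).1.ofReal, (him.mono_set hs).2.ofReal⟩
      exact him'.smul Complex.I
  -- Absolute continuity only involves values at points of `uIcc a b`, so the splitting into real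
  -- and imaginary parts is needed only there.
  rw [absolutelyContinuousOnInterval_iff] at h3 ⊢
  intro ε hε
  obtain ⟨δ, hδ, h⟩ := h3 ε hε
  refine ⟨δ, hδ, fun E hE hlt => ?_⟩
  convert h E hE hlt using 3 with i hi
  · exact hEq _ (hE.1 i hi).1
  · exact hEq _ (hE.1 i hi).2

/-- The difference of `F` and the primitive of `f` is absolutely continuous with derivative zero
almost everywhere, hence constant. -/
theorem integral_eq_sub_of_absolutelyContinuousOnInterval {F f : ℝ → ℂ} {a b : ℝ}
    (hF : AbsolutelyContinuousOnInterval F a b) (hf : IntervalIntegrable f volume a b)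
    (hd : ∀ᵐ x, x ∈ uIcc a b → HasDerivAt F (f x) x) : ∫ x in a..b, f x = F b - F a := by
  obtain ⟨C, hC⟩ := (hF.fun_sub
    (absolutelyContinuousOnInterval_integral hf)).const_of_ae_hasDerivAt_zero (by
      filter_upwards [hd, hf.ae_hasDerivAt_integral] with x h1 h2 hx
      exact ((h1 hx).sub (h2 hx a left_mem_uIcc)).congr_deriv (sub_self _))
  have ha := hC a left_mem_uIcc
  have hb := hC b right_mem_uIcc
  simp only [intervalIntegral.integral_same, sub_zero] at ha
  rw [ha, ← hb]
  ring

/-! ### Absolutely continuous representatives -/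

theorem ae_uIcc_of_ae_Ioo {ℓ : ℝ} (hℓ : 0 < ℓ) {p : ℝ → Prop}
    (h : ∀ᵐ x ∂volume.restrict (Ioo 0 ℓ), p x) : ∀ᵐ x, x ∈ uIcc 0 ℓ → p x := by
  rw [uIcc_of_le hℓ.le, ← ae_restrict_iff' measurableSet_Icc]
  rwa [Measure.restrict_congr_set Ioo_ae_eq_Icc] at h

theorem integrable_coe {ℓ : ℝ} (ξ : L2 ℓ) : Integrable ξ (volume.restrict (Ioo 0 ℓ)) :=
  (Lp.memLp ξ).integrable (by norm_num)

theorem intervalIntegrable_of_Ioo {ℓ : ℝ} (hℓ : 0 < ℓ) {f : ℝ → ℂ}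
    (hf : Integrable f (volume.restrict (Ioo 0 ℓ))) : IntervalIntegrable f volume 0 ℓ := by
  rw [intervalIntegrable_iff_integrableOn_Ioo_of_le hℓ.le]
  exact hf

theorem integral_Ioo_eq {ℓ : ℝ} (hℓ : 0 < ℓ) (f : ℝ → ℂ) :
    ∫ x in Ioo 0 ℓ, f x = ∫ x in 0..ℓ, f x := by
  rw [intervalIntegral.integral_of_le hℓ.le, integral_Ioc_eq_integral_Ioo]

/-- `g` is an absolutely continuous representative of `ξ` whose derivative is `η`. -/
structure IsRep (ℓ : ℝ) (ξ η : L2 ℓ) (g : ℝ → ℂ) : Prop where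
  ac : AbsolutelyContinuousOnInterval g 0 ℓ
  ae_eq : ξ =ᵐ[volume.restrict (Ioo 0 ℓ)] g
  deriv : ∀ᵐ x ∂volume.restrict (Ioo 0 ℓ), HasDerivAt g (η x) x

theorem _root_.AbsolutelyContinuousOnInterval.star {f : ℝ → ℂ} {a b : ℝ}
    (hf : AbsolutelyContinuousOnInterval f a b) :
    AbsolutelyContinuousOnInterval (fun x => conj (f x)) a b := by
  rw [absolutelyContinuousOnInterval_iff] at hf ⊢
  simpa [Complex.dist_conj_conj] using hf

theorem inner_eq_integral {ℓ : ℝ} (ξ η : L2 ℓ) :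
    inner ℂ ξ η = ∫ x in Ioo 0 ℓ, conj (ξ x) * η x := by
  rw [L2.inner_def]
  refine integral_congr_ae (Eventually.of_forall fun x => ?_)
  simp [mul_comm]

theorem integrable_conj_mul_coe {ℓ : ℝ} (ξ η : L2 ℓ) :
    Integrable (fun x => conj (ξ x) * η x) (volume.restrict (Ioo 0 ℓ)) := by
  refine (L2.integrable_inner (𝕜 := ℂ) ξ η).congr (Eventually.of_forall fun x => ?_)
  simp [mul_comm]

/-- Integration by parts. -/
theorem IsRep.inner_add_inner {ℓ : ℝ} (hℓ : 0 < ℓ) {ξ η u v : L2 ℓ} {g h : ℝ → ℂ}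
    (hg : IsRep ℓ ξ η g) (hh : IsRep ℓ u v h) :
    inner ℂ ξ v + inner ℂ η u = conj (g ℓ) * h ℓ - conj (g 0) * h 0 := by
  have hac : AbsolutelyContinuousOnInterval (fun x => conj (g x) * h x) 0 ℓ :=
    hg.ac.star.fun_smul hh.ac
  have hint := (integrable_conj_mul_coe ξ v).add (integrable_conj_mul_coe η u)
  rw [← integral_eq_sub_of_absolutelyContinuousOnInterval hac
    (intervalIntegrable_of_Ioo hℓ hint), ← integral_Ioo_eq hℓ, inner_eq_integral,
    inner_eq_integral, ← integral_add (integrable_conj_mul_coe ξ v)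
    (integrable_conj_mul_coe η u)]
  · rfl
  · refine ae_uIcc_of_ae_Ioo hℓ ?_
    filter_upwards [hg.deriv, hh.deriv, hg.ae_eq, hh.ae_eq] with x h1 h2 h3 h4
    refine (h1.star.mul h2).congr_deriv ?_
    simp only [Pi.add_apply, h3, h4]
    rw [add_comm]
    rfl

theorem memLp_of_continuousOn {ℓ : ℝ} {g : ℝ → ℂ} (hg : ContinuousOn g (Icc 0 ℓ)) :
    MemLp g 2 (volume.restrict (Ioo 0 ℓ)) := by
  obtain ⟨C, hC⟩ := (isCompact_Icc (a := (0 : ℝ)) (b := ℓ)).exists_bound_of_continuousOn hg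
  refine MemLp.of_bound
    ((hg.mono Ioo_subset_Icc_self).aestronglyMeasurable measurableSet_Ioo) C ?_
  filter_upwards [ae_restrict_mem measurableSet_Ioo] with x hx
  exact hC x (Ioo_subset_Icc_self hx)

theorem IsRep.continuousOn {ℓ : ℝ} (hℓ : 0 < ℓ) {ξ η : L2 ℓ} {g : ℝ → ℂ} (h : IsRep ℓ ξ η g) :
    ContinuousOn g (Icc 0 ℓ) := by
  have := h.ac.continuousOn
  rwa [uIcc_of_le hℓ.le] at this

/-- The primitive of `η` starting at `c`. Both end values are recorded because they decide which
boundary conditions can be met. -/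
theorem exists_isRep {ℓ : ℝ} (hℓ : 0 < ℓ) (η : L2 ℓ) (c : ℂ) :
    ∃ ξ : L2 ℓ, ∃ g, IsRep ℓ ξ η g ∧ g 0 = c ∧ g ℓ = c + ∫ x in Ioo 0 ℓ, η x := by
  have hη := intervalIntegrable_of_Ioo hℓ (integrable_coe η)
  have hac : AbsolutelyContinuousOnInterval (fun x => c + ∫ t in 0..x, η t) 0 ℓ :=
    (contDiff_const.contDiffOn).absolutelyContinuousOnInterval.fun_add
      (absolutelyContinuousOnInterval_integral hη)
  have hcont := hac.continuousOn
  rw [uIcc_of_le hℓ.le] at hcont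
  refine ⟨(memLp_of_continuousOn hcont).toLp _, _, ⟨hac, MemLp.coeFn_toLp _, ?_⟩, ?_, ?_⟩
  · have := hη.ae_hasDerivAt_integral
    filter_upwards [ae_restrict_of_ae this, ae_restrict_mem measurableSet_Ioo] with x hx hxI
    refine HasDerivAt.const_add _ (hx ?_ 0 left_mem_uIcc)
    rw [uIcc_of_le hℓ.le]
    exact Ioo_subset_Icc_self hxI
  · simp
  · rw [integral_Ioo_eq hℓ]

theorem eqOn_Icc_of_ae_eq {ℓ : ℝ} (hℓ : 0 < ℓ) {g h : ℝ → ℂ} (hg : ContinuousOn g (Icc 0 ℓ))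
    (hh : ContinuousOn h (Icc 0 ℓ)) (e : g =ᵐ[volume.restrict (Ioo 0 ℓ)] h) :
    EqOn g h (Icc 0 ℓ) := by
  refine Measure.eqOn_Icc_of_ae_eq volume hℓ.ne ?_ hg hh
  rwa [Measure.restrict_congr_set Ioo_ae_eq_Icc.symm]

/-! ### Test functions -/

theorem IsTestFun.mono {I J : Set ℝ} {φ : ℝ → ℂ} (h : IsTestFun I φ) (hIJ : I ⊆ J) :
    IsTestFun J φ := ⟨h.smooth, h.compactSupport, h.support_subset.trans hIJ⟩

theorem IsTestFun.eq_zero {I : Set ℝ} {φ : ℝ → ℂ} (h : IsTestFun I φ) {x : ℝ} (hx : x ∉ I) :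
    φ x = 0 :=
  image_eq_zero_of_notMem_tsupport fun h' => hx (h.support_subset h')

theorem IsTestFun.deriv {I : Set ℝ} {φ : ℝ → ℂ} (h : IsTestFun I φ) : IsTestFun I (deriv φ) :=
  ⟨(contDiff_infty_iff_deriv.1 h.smooth).2, h.compactSupport.deriv,
    (tsupport_deriv_subset (𝕜 := ℝ)).trans h.support_subset⟩

/-- The restriction of a test function to `(0,ℓ)`. -/
def IsTestFun.toL2 (ℓ : ℝ) {I : Set ℝ} {φ : ℝ → ℂ} (h : IsTestFun I φ) : L2 ℓ :=
  (memLp_of_continuousOn (ℓ := ℓ) h.smooth.continuous.continuousOn).toLp φ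

theorem IsTestFun.coeFn_toL2 (ℓ : ℝ) {I : Set ℝ} {φ : ℝ → ℂ} (h : IsTestFun I φ) :
    h.toL2 ℓ =ᵐ[volume.restrict (Ioo 0 ℓ)] φ := MemLp.coeFn_toLp _

theorem IsTestFun.isRep {ℓ : ℝ} {I : Set ℝ} {φ : ℝ → ℂ} (h : IsTestFun I φ) {ξ η : L2 ℓ}
    (hξ : ξ =ᵐ[volume.restrict (Ioo 0 ℓ)] φ)
    (hη : η =ᵐ[volume.restrict (Ioo 0 ℓ)] _root_.deriv φ) : IsRep ℓ ξ η φ where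
  ac := (h.smooth.of_le (by exact_mod_cast le_top)).contDiffOn.absolutelyContinuousOnInterval
  ae_eq := hξ
  deriv := by
    filter_upwards [hη] with x hx
    rw [hx]
    exact (h.smooth.differentiable (by simp) x).hasDerivAt

theorem inner_toL2 {ℓ : ℝ} {I : Set ℝ} {φ : ℝ → ℂ} (h : IsTestFun I φ) (ξ : L2 ℓ) :
    inner ℂ ξ (h.toL2 ℓ) = ∫ x in Ioo 0 ℓ, conj (ξ x) * φ x := by
  rw [inner_eq_integral]
  refine integral_congr_ae ?_
  filter_upwards [h.coeFn_toL2 ℓ] with x hx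
  rw [hx]

theorem isWeakDeriv_one_iff {ℓ : ℝ} {ξ η : L2 ℓ} :
    IsWeakDeriv ℓ 1 ξ η ↔ ∀ φ : ℝ → ℂ, ∀ h : IsTestFun (Ioo 0 ℓ) φ,
      inner ℂ ξ (h.deriv.toL2 ℓ) + inner ℂ η (h.toL2 ℓ) = 0 := by
  refine forall_congr' fun φ => forall_congr' fun h => ?_
  rw [inner_toL2, inner_toL2, pow_one, neg_one_mul, iteratedDeriv_one, add_comm,
    ← eq_neg_iff_add_eq_zero]

/-- The hypothesis makes `η` a weak derivative of order zero of the zero function. -/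
theorem eq_zero_of_inner_test {ℓ : ℝ} {η : L2 ℓ}
    (h : ∀ φ : ℝ → ℂ, ∀ hφ : IsTestFun (Ioo 0 ℓ) φ, inner ℂ η (hφ.toL2 ℓ) = 0) : η = 0 := by
  refine eq_zero_of_isWeakDeriv_zero (s := 0) fun φ hφ => ?_
  rw [← inner_toL2 hφ, h φ hφ, pow_zero, one_mul]
  have := integral_smul_conj ℓ 0 (0 : L2 ℓ) (iteratedDeriv 0 φ)
  simpa using this.symm

theorem IsRep.isWeakDeriv {ℓ : ℝ} (hℓ : 0 < ℓ) {ξ η : L2 ℓ} {g : ℝ → ℂ} (h : IsRep ℓ ξ η g) :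
    IsWeakDeriv ℓ 1 ξ η := by
  rw [isWeakDeriv_one_iff]
  intro φ hφ
  rw [h.inner_add_inner hℓ (hφ.isRep (hφ.coeFn_toL2 ℓ) (hφ.deriv.coeFn_toL2 ℓ)),
    hφ.eq_zero (by simp), hφ.eq_zero (by simp)]
  simp

/-- A test function of integral zero is the derivative of a test function. -/
theorem IsTestFun.exists_primitive {ℓ : ℝ} {θ : ℝ → ℂ} (h : IsTestFun (Ioo 0 ℓ) θ)
    (h0 : ∫ x in Ioo 0 ℓ, θ x = 0) : ∃ φ, IsTestFun (Ioo 0 ℓ) φ ∧ _root_.deriv φ = θ := by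
  rcases (tsupport θ).eq_empty_or_nonempty with he | hne
  · rw [tsupport_eq_empty_iff] at he
    subst he
    exact ⟨0, h, by ext; simp⟩
  have hK : IsCompact (tsupport θ) := h.compactSupport
  obtain ⟨a, ha, hal⟩ := hK.exists_isLeast hne
  obtain ⟨b, hb, hbu⟩ := hK.exists_isGreatest hne
  have ha' := h.support_subset ha
  have hb' := h.support_subset hb
  have hza : ∀ x < a, θ x = 0 := fun x hx =>
    image_eq_zero_of_notMem_tsupport fun hx' => absurd (hal hx') (not_le.2 hx)
  have hzb : ∀ x > b, θ x = 0 := fun x hx =>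
    image_eq_zero_of_notMem_tsupport fun hx' => absurd (hbu hx') (not_le.2 hx)
  have hcont := h.smooth.continuous
  have hd : ∀ x, HasDerivAt (fun x => ∫ t in a..x, θ t) (θ x) x := fun x =>
    intervalIntegral.integral_hasDerivAt_right (hcont.intervalIntegrable _ _)
      hcont.stronglyMeasurable.stronglyMeasurableAtFilter hcont.continuousAt
  have hderiv : _root_.deriv (fun x => ∫ t in a..x, θ t) = θ := funext fun x => (hd x).deriv
  have hab : ∫ t in a..b, θ t = 0 := by
    rw [integral_Ioo_eq (ha'.1.trans ha'.2)] at h0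
    rw [← h0, ← intervalIntegral.integral_add_adjacent_intervals (a := 0) (b := a)
      (hcont.intervalIntegrable _ _) (hcont.intervalIntegrable _ _),
      ← intervalIntegral.integral_add_adjacent_intervals (a := a) (b := b) (c := ℓ)
      (hcont.intervalIntegrable _ _) (hcont.intervalIntegrable _ _)]
    have h1 : ∫ t in 0..a, θ t = 0 := by
      refine intervalIntegral.integral_zero_ae ?_
      have : ∀ᵐ x : ℝ, x ≠ a := by simp [ae_iff, measure_singleton]
      filter_upwards [this] with x hx hx'
      rw [uIoc_of_le ha'.1.le] at hx'
      exact hza x (lt_of_le_of_ne hx'.2 hx)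
    have h2 : ∫ t in b..ℓ, θ t = 0 := by
      refine intervalIntegral.integral_zero_ae (Eventually.of_forall fun x hx => ?_)
      rw [uIoc_of_le hb'.2.le] at hx
      exact hzb x hx.1
    rw [h1, h2]
    ring
  -- The primitive starts at the least point `a` of the support, so it vanishes to the left of `a`;
  -- to the right of the greatest point `b` it equals the total integral, which is zero.
  have hsupp : tsupport (fun x => ∫ t in a..x, θ t) ⊆ Icc a b := by
    refine closure_minimal (fun x hx => ?_) isClosed_Icc
    by_contra hxab
    apply hx
    rw [mem_Icc, not_and_or, not_le, not_le] at hxab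
    rcases hxab with hxa | hxb
    · refine intervalIntegral.integral_zero_ae ?_
      have : ∀ᵐ x : ℝ, x ≠ a := by simp [ae_iff, measure_singleton]
      filter_upwards [this] with y hy hy'
      rw [uIoc_of_ge hxa.le] at hy'
      exact hza y (lt_of_le_of_ne hy'.2 hy)
    · change ∫ t in a..x, θ t = 0
      rw [← intervalIntegral.integral_add_adjacent_intervals (a := a) (b := b)
        (hcont.intervalIntegrable _ _) (hcont.intervalIntegrable _ _), hab, zero_add]
      refine intervalIntegral.integral_zero_ae (Eventually.of_forall fun y hy => ?_)
      rw [uIoc_of_le hxb.le] at hy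
      exact hzb y hy.1
  refine ⟨fun x => ∫ t in a..x, θ t, ⟨?_, ?_, ?_⟩, hderiv⟩
  · rw [contDiff_infty_iff_deriv, hderiv]
    exact ⟨fun x => (hd x).differentiableAt, h.smooth⟩
  · exact HasCompactSupport.of_support_subset_isCompact isCompact_Icc
      (subset_closure.trans hsupp)
  · exact hsupp.trans fun x hx => ⟨ha'.1.trans_le hx.1, hx.2.trans_lt hb'.2⟩

/-- A test function with prescribed support and value one at a given point. -/
theorem exists_isTestFun {I : Set ℝ} {x : ℝ} (hI : I ∈ 𝓝 x) :
    ∃ f : ℝ → ℝ, IsTestFun I (fun t => (f t : ℂ)) ∧ (∀ t, 0 ≤ f t) ∧ f x = 1 := by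
  obtain ⟨f, hs, hc, hd, hr, hx⟩ := exists_contDiff_tsupport_subset (n := ⊤) hI
  refine ⟨f, ⟨Complex.ofRealCLM.contDiff.comp hd,
    hc.comp_left (g := fun r : ℝ => (r : ℂ)) (by simp),
    (tsupport_comp_subset (g := fun r : ℝ => (r : ℂ)) (by simp) f).trans hs⟩,
    fun t => (hr ⟨t, rfl⟩).1, hx⟩

/-! ### Representatives of weakly differentiable functions -/

/-- The constant function `c`. -/
def constL2 (ℓ : ℝ) (c : ℂ) : L2 ℓ :=
  (memLp_of_continuousOn (ℓ := ℓ) (g := fun _ => c) continuousOn_const).toLp _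

theorem coeFn_constL2 (ℓ : ℝ) (c : ℂ) :
    constL2 ℓ c =ᵐ[volume.restrict (Ioo 0 ℓ)] fun _ => c := MemLp.coeFn_toLp _

theorem isRep_constL2 (ℓ : ℝ) (c : ℂ) : IsRep ℓ (constL2 ℓ c) 0 (fun _ => c) where
  ac := (contDiff_const.contDiffOn).absolutelyContinuousOnInterval
  ae_eq := coeFn_constL2 ℓ c
  deriv := by
    filter_upwards [Lp.coeFn_zero ℂ 2 (volume.restrict (Ioo (0 : ℝ) ℓ))] with x hx
    rw [hx]
    exact hasDerivAt_const x c

theorem inner_constL2_left {ℓ : ℝ} (c : ℂ) (ξ : L2 ℓ) :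
    inner ℂ (constL2 ℓ c) ξ = conj c * ∫ x in Ioo 0 ℓ, ξ x := by
  rw [inner_eq_integral, ← integral_const_mul]
  refine integral_congr_ae ?_
  filter_upwards [coeFn_constL2 ℓ c] with x hx
  rw [hx]

theorem IsRep.add {ℓ : ℝ} {ξ η u v : L2 ℓ} {g h : ℝ → ℂ} (hg : IsRep ℓ ξ η g)
    (hh : IsRep ℓ u v h) : IsRep ℓ (ξ + u) (η + v) (fun x => g x + h x) where
  ac := hg.ac.fun_add hh.ac
  ae_eq := by
    filter_upwards [Lp.coeFn_add ξ u, hg.ae_eq, hh.ae_eq] with x h0 h1 h2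
    rw [h0, Pi.add_apply, h1, h2]
  deriv := by
    filter_upwards [Lp.coeFn_add η v, hg.deriv, hh.deriv] with x h0 h1 h2
    rw [h0, Pi.add_apply]
    exact h1.add h2

theorem IsTestFun.sub_smul {I : Set ℝ} {φ ψ : ℝ → ℂ} (hφ : IsTestFun I φ) (hψ : IsTestFun I ψ)
    (c : ℂ) : IsTestFun I (fun x => φ x - c * ψ x) where
  smooth := hφ.smooth.sub (contDiff_const.mul hψ.smooth)
  compactSupport := hφ.compactSupport.sub hψ.compactSupport.mul_left
  support_subset := (tsupport_sub _ _).trans (union_subset hφ.support_subset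
    ((tsupport_mul_subset_right (f := fun _ => c)).trans hψ.support_subset))

theorem IsTestFun.integrable {ℓ : ℝ} {I : Set ℝ} {φ : ℝ → ℂ} (h : IsTestFun I φ) :
    Integrable φ (volume.restrict (Ioo 0 ℓ)) :=
  (memLp_of_continuousOn (ℓ := ℓ) h.smooth.continuous.continuousOn).integrable (by norm_num)

theorem exists_isTestFun_integral_ne_zero {ℓ : ℝ} (hℓ : 0 < ℓ) :
    ∃ ψ, IsTestFun (Ioo 0 ℓ) ψ ∧ ∫ x in Ioo 0 ℓ, ψ x ≠ 0 := by
  obtain ⟨f, hf, h0, h1⟩ := exists_isTestFun (I := Ioo 0 ℓ) (x := ℓ / 2)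
    (Ioo_mem_nhds (by linarith) (by linarith))
  refine ⟨_, hf, ?_⟩
  have hzero : ∀ x, x ∉ Ioo 0 ℓ → f x = 0 := fun x hx => by exact_mod_cast hf.eq_zero hx
  have hcont : Continuous f := by
    have := Complex.continuous_re.comp hf.smooth.continuous
    simpa [Function.comp_def] using this
  have hpos : 0 < ∫ x, f x := by
    refine hcont.integral_pos_of_hasCompactSupport_nonneg_nonzero (x := ℓ / 2) ?_ h0 (by simp [h1])
    have := hf.compactSupport.comp_left (g := Complex.re) (by simp)
    simpa [Function.comp_def] using this
  rw [integral_complex_ofReal, setIntegral_eq_integral_of_forall_compl_eq_zero hzero]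
  exact_mod_cast hpos.ne'

/-- A function with vanishing weak derivative is constant. -/
theorem eq_constL2_of_isWeakDeriv_zero {ℓ : ℝ} (hℓ : 0 < ℓ) {u : L2 ℓ}
    (hu : IsWeakDeriv ℓ 1 u 0) : ∃ c, u = constL2 ℓ c := by
  obtain ⟨ψ, hψ, hm⟩ := exists_isTestFun_integral_ne_zero hℓ
  set m := ∫ x in Ioo 0 ℓ, ψ x with hm_def
  -- The constant must be the `ψ / m`-average of `u`, conjugated because the pairing is antilinear
  -- in `u`. Any test function `χ` minus the multiple of `ψ` with the same integral is the
  -- derivative of a test function, so `u` annihilates it.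
  refine ⟨conj ((∫ x in Ioo 0 ℓ, conj (u x) * ψ x) / m), sub_eq_zero.1 ?_⟩
  refine eq_zero_of_inner_test fun χ hχ => ?_
  have hθ := hχ.sub_smul hψ ((∫ x in Ioo 0 ℓ, χ x) / m)
  obtain ⟨φ, hφ, hd⟩ := hθ.exists_primitive (by
    rw [integral_sub hχ.integrable (hψ.integrable.const_mul _), integral_const_mul, ← hm_def,
      div_mul_cancel₀ _ hm, sub_self])
  have h1 := hu φ hφ
  have h2 : ∫ x in Ioo 0 ℓ, conj ((0 : L2 ℓ) x) * φ x = 0 := by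
    simpa using integral_smul_conj ℓ 0 (0 : L2 ℓ) φ
  rw [h2, iteratedDeriv_one, hd, pow_one, neg_one_mul, eq_comm, neg_eq_zero] at h1
  have h3 : ∫ x in Ioo 0 ℓ, conj (u x) * (χ x - (∫ x in Ioo 0 ℓ, χ x) / m * ψ x) =
      (∫ x in Ioo 0 ℓ, conj (u x) * χ x) -
        (∫ x in Ioo 0 ℓ, χ x) / m * ∫ x in Ioo 0 ℓ, conj (u x) * ψ x := by
    rw [← integral_const_mul, ← integral_sub
      (integrable_conj_mul ℓ u hχ.smooth.continuous)
      ((integrable_conj_mul ℓ u hψ.smooth.continuous).const_mul _)]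
    refine integral_congr_ae (Eventually.of_forall fun x => ?_)
    simp only
    ring
  rw [h3] at h1
  have h4 : ∫ x in Ioo 0 ℓ, hχ.toL2 ℓ x = ∫ x in Ioo 0 ℓ, χ x :=
    integral_congr_ae (hχ.coeFn_toL2 ℓ)
  rw [inner_sub_left, inner_toL2, inner_constL2_left, Complex.conj_conj, h4,
    sub_eq_zero.1 h1]
  ring

/-- Subtracting a primitive of `η` from `ξ` leaves a function with weak derivative zero, that is, a
constant. -/
theorem IsWeakDeriv.exists_isRep {ℓ : ℝ} (hℓ : 0 < ℓ) {ξ η : L2 ℓ} (h : IsWeakDeriv ℓ 1 ξ η) :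
    ∃ g, IsRep ℓ ξ η g := by
  obtain ⟨ξ₀, g₀, h₀, -, -⟩ := Beam.exists_isRep hℓ η 0
  have hsub : IsWeakDeriv ℓ 1 (ξ - ξ₀) (η - η) :=
    (weakDerivGraph ℓ).sub_mem (x := (ξ, η)) (y := (ξ₀, η)) h (h₀.isWeakDeriv hℓ)
  rw [sub_self] at hsub
  obtain ⟨c, hc⟩ := eq_constL2_of_isWeakDeriv_zero hℓ hsub
  have := h₀.add (isRep_constL2 ℓ c)
  rw [← hc, add_zero, add_sub_cancel] at this
  exact ⟨_, this⟩

theorem IsWeakDeriv.unique {ℓ : ℝ} {s : ℕ} {ξ η₁ η₂ : L2 ℓ} (h₁ : IsWeakDeriv ℓ s ξ η₁)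
    (h₂ : IsWeakDeriv ℓ s ξ η₂) : η₁ = η₂ := by
  have h := h₁.add (h₂.smul (-1))
  rw [neg_one_smul, neg_one_smul, add_neg_cancel, ← sub_eq_add_neg] at h
  exact sub_eq_zero.1 (eq_zero_of_isWeakDeriv_zero h)

theorem IsRep.eqOn {ℓ : ℝ} (hℓ : 0 < ℓ) {ξ η : L2 ℓ} {g h : ℝ → ℂ} (hg : IsRep ℓ ξ η g)
    (hh : ContinuousOn h (Icc 0 ℓ)) (e : ξ =ᵐ[volume.restrict (Ioo 0 ℓ)] h) :
    EqOn g h (Icc 0 ℓ) :=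
  eqOn_Icc_of_ae_eq hℓ (hg.continuousOn hℓ) hh (hg.ae_eq.symm.trans e)

theorem End.pos_mem {ℓ : ℝ} (hℓ : 0 < ℓ) (e : End) : e.pos ℓ ∈ Icc 0 ℓ := by
  cases e
  · exact left_mem_Icc.2 hℓ.le
  · exact right_mem_Icc.2 hℓ.le

/-- Weak derivatives are unique, and continuous representatives agree up to the ends, so any one
representative may be used to test a boundary condition. -/
theorem vanishesAt_iff {ℓ : ℝ} (hℓ : 0 < ℓ) {k : ℕ} {e : End} {ξ η ζ : L2 ℓ} {g : ℝ → ℂ}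
    (hk : IsWeakDeriv ℓ k ξ η) (hg : IsRep ℓ η ζ g) : VanishesAt ℓ k e ξ ↔ g (e.pos ℓ) = 0 := by
  constructor
  · rintro ⟨η', hη', h, hc, he, h0⟩
    rw [hη'.unique hk] at he
    rw [hg.eqOn hℓ hc he (e.pos_mem hℓ), h0]
  · intro h0
    exact ⟨η, hk, g, hg.continuousOn hℓ, hg.ae_eq, h0⟩

/-! ### The graphs of the first-order operators -/

/-- The opposite boundary condition. -/
def Sgn.neg : Sgn → Sgn
  | .plus => .minus
  | .minus => .plus

@[simp]
theorem Sgn.neg_neg (a : Sgn) : a.neg.neg = a := by cases a <;> rfl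

/-- `ξ ∈ W¹` satisfies the boundary conditions given by the signs `a`, `b`, and `ξ' = η`. -/
def IsDelta (ℓ : ℝ) (a b : Sgn) (ξ η : L2 ℓ) : Prop :=
  ∃ g, IsRep ℓ ξ η g ∧ (a = .plus → g 0 = 0) ∧ (b = .plus → g ℓ = 0)

theorem IsDelta.isWeakDeriv {ℓ : ℝ} (hℓ : 0 < ℓ) {a b : Sgn} {ξ η : L2 ℓ}
    (h : IsDelta ℓ a b ξ η) : IsWeakDeriv ℓ 1 ξ η := by
  obtain ⟨g, hg, -⟩ := h
  exact hg.isWeakDeriv hℓ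

/-- With complementary signs, one of the two functions vanishes at each end, so integration by parts
has no boundary terms. -/
theorem IsDelta.inner_add_inner {ℓ : ℝ} (hℓ : 0 < ℓ) {a b : Sgn} {ξ η u v : L2 ℓ}
    (h : IsDelta ℓ a b ξ η) (h' : IsDelta ℓ a.neg b.neg u v) :
    inner ℂ ξ v + inner ℂ η u = 0 := by
  obtain ⟨g, hg, ga, gb⟩ := h
  obtain ⟨k, hk, ka, kb⟩ := h'
  rw [hg.inner_add_inner hℓ hk]
  have h1 : conj (g ℓ) * k ℓ = 0 := by
    cases b
    · simp [gb rfl]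
    · simp [kb rfl]
  have h2 : conj (g 0) * k 0 = 0 := by
    cases a
    · simp [ga rfl]
    · simp [ka rfl]
  rw [h1, h2, sub_zero]

theorem Ioo_subset_testInterval (ℓ : ℝ) (a b : Sgn) : Ioo 0 ℓ ⊆ testInterval ℓ a b := by
  cases a <;> cases b
  · exact Subset.rfl
  · exact Ioo_subset_Ioi_self
  · exact Ioo_subset_Iio_self
  · exact subset_univ _

theorem IsTestFun.isDelta {ℓ : ℝ} {a b : Sgn} {φ : ℝ → ℂ}
    (h : IsTestFun (testInterval ℓ a b) φ) {ξ η : L2 ℓ}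
    (hξ : ξ =ᵐ[volume.restrict (Ioo 0 ℓ)] φ)
    (hη : η =ᵐ[volume.restrict (Ioo 0 ℓ)] _root_.deriv φ) : IsDelta ℓ a b ξ η := by
  refine ⟨φ, h.isRep hξ hη, ?_, ?_⟩
  · rintro rfl
    refine h.eq_zero ?_
    cases b <;> simp [testInterval]
  · rintro rfl
    refine h.eq_zero ?_
    cases a <;> simp [testInterval]

theorem testInterval_minus_mem_nhds_zero {ℓ : ℝ} (hℓ : 0 < ℓ) (b : Sgn) :
    testInterval ℓ .minus b ∈ 𝓝 0 := by
  cases b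
  · exact Iio_mem_nhds hℓ
  · exact univ_mem

theorem testInterval_minus_mem_nhds {ℓ : ℝ} (hℓ : 0 < ℓ) (a : Sgn) :
    testInterval ℓ a .minus ∈ 𝓝 ℓ := by
  cases a
  · exact Ioi_mem_nhds hℓ
  · exact univ_mem

/-- A pair annihilated by the test functions for the signs `a`, `b` satisfies the complementary
boundary conditions. -/
theorem isDelta_neg_of_inner_test {ℓ : ℝ} (hℓ : 0 < ℓ) {a b : Sgn} {u v : L2 ℓ}
    (h : ∀ φ : ℝ → ℂ, ∀ hφ : IsTestFun (testInterval ℓ a b) φ,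
      inner ℂ u (hφ.deriv.toL2 ℓ) + inner ℂ v (hφ.toL2 ℓ) = 0) :
    IsDelta ℓ a.neg b.neg u v := by
  obtain ⟨g, hg⟩ := IsWeakDeriv.exists_isRep hℓ (isWeakDeriv_one_iff.2 fun φ hφ =>
    h φ (hφ.mono (Ioo_subset_testInterval ℓ a b)))
  have hbd : ∀ φ : ℝ → ℂ, IsTestFun (testInterval ℓ a b) φ →
      conj (g ℓ) * φ ℓ - conj (g 0) * φ 0 = 0 := by
    intro φ hφ
    rw [← h φ hφ, hg.inner_add_inner hℓ
      (hφ.isRep (hφ.coeFn_toL2 ℓ) (hφ.deriv.coeFn_toL2 ℓ))]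
  refine ⟨g, hg, fun ha => ?_, fun hb => ?_⟩
  · have ha' : a = .minus := by cases a <;> simp_all [Sgn.neg]
    subst ha'
    -- Test functions are unrestricted at a `minus` end. One that equals one here and vanishes at
    -- the other end isolates a single boundary term.
    obtain ⟨f, hf, -, h1⟩ := exists_isTestFun
      (inter_mem (testInterval_minus_mem_nhds_zero hℓ b) (Iio_mem_nhds hℓ))
    have h2 := hbd _ (hf.mono inter_subset_left)
    have h3 : (f ℓ : ℂ) = 0 := hf.eq_zero (by simp)
    simpa [h3, h1] using h2
  · have hb' : b = .minus := by cases b <;> simp_all [Sgn.neg]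
    subst hb'
    obtain ⟨f, hf, -, h1⟩ := exists_isTestFun
      (inter_mem (testInterval_minus_mem_nhds hℓ a) (Ioi_mem_nhds hℓ))
    have h2 := hbd _ (hf.mono inter_subset_left)
    have h3 : (f 0 : ℂ) = 0 := hf.eq_zero (by simp)
    simpa [h3, h1] using h2

theorem IsTestFun.mem_testGraph {ℓ : ℝ} {I : Set ℝ} {φ : ℝ → ℂ} (h : IsTestFun I φ) :
    (h.toL2 ℓ, h.deriv.toL2 ℓ) ∈ testGraph ℓ I :=
  ⟨φ, h, h.coeFn_toL2 ℓ, h.deriv.coeFn_toL2 ℓ⟩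

/-- The closure is the double orthogonal complement, computed in the Hilbert space `WithLp 2 (E ×
F)`, whose topology is that of the product. -/
theorem _root_.Submodule.mem_topologicalClosure_of_forall_inner {𝕜 E F : Type*} [RCLike 𝕜]
    [NormedAddCommGroup E] [InnerProductSpace 𝕜 E] [CompleteSpace E]
    [NormedAddCommGroup F] [InnerProductSpace 𝕜 F] [CompleteSpace F]
    (K : Submodule 𝕜 (E × F)) (p : E × F)
    (h : ∀ u v, (∀ q ∈ K, inner 𝕜 q.1 u + inner 𝕜 q.2 v = 0) →
      inner 𝕜 p.1 u + inner 𝕜 p.2 v = 0) : p ∈ K.topologicalClosure := by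
  set K' : Submodule 𝕜 (WithLp 2 (E × F)) :=
    K.comap (WithLp.linearEquiv 2 𝕜 (E × F)).toLinearMap with hK'
  have hp : WithLp.toLp 2 p ∈ K'.topologicalClosure := by
    rw [← Submodule.orthogonal_orthogonal_eq_closure, Submodule.mem_orthogonal']
    intro w hw
    rw [Submodule.mem_orthogonal] at hw
    have := h w.fst w.snd fun q hq => by
      have := hw (WithLp.toLp 2 q) hq
      simpa [WithLp.prod_inner_apply] using this
    simpa [WithLp.prod_inner_apply] using this
  have hc : Continuous (WithLp.ofLp : WithLp 2 (E × F) → E × F) :=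
    WithLp.prod_continuous_ofLp 2 E F
  exact closure_mono (by rintro _ ⟨w, hw, rfl⟩; exact hw)
    (image_closure_subset_closure_image hc ⟨_, hp, rfl⟩)

/-- A duality argument replaces explicit approximation. Pairing with a test function for the
complementary signs is continuous and vanishes on the test graph, hence on its closure, and this
forces the boundary conditions. Conversely, if `(u, v)` is orthogonal to the test graph, then `(v,
u)` satisfies the complementary conditions, so `(u, v)` is orthogonal to `p` as well. -/
theorem mem_closure_testGraph_iff {ℓ : ℝ} (hℓ : 0 < ℓ) {a b : Sgn} {p : L2 ℓ × L2 ℓ} :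
    p ∈ (testGraph ℓ (testInterval ℓ a b)).topologicalClosure ↔ IsDelta ℓ a b p.1 p.2 := by
  constructor
  · intro hp
    rw [← a.neg_neg, ← b.neg_neg]
    refine isDelta_neg_of_inner_test hℓ fun φ hφ => ?_
    have hcl : IsClosed {p : L2 ℓ × L2 ℓ |
        inner ℂ p.1 (hφ.deriv.toL2 ℓ) + inner ℂ p.2 (hφ.toL2 ℓ) = 0} :=
      isClosed_eq (by fun_prop) continuous_const
    refine closure_minimal ?_ hcl hp
    rintro q ⟨ψ, hψ, h1, h2⟩
    exact (hψ.isDelta h1 h2).inner_add_inner hℓ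
      (hφ.isDelta (hφ.coeFn_toL2 ℓ) (hφ.deriv.coeFn_toL2 ℓ))
  · intro hp
    refine Submodule.mem_topologicalClosure_of_forall_inner _ _ fun u v huv => ?_
    refine hp.inner_add_inner hℓ (isDelta_neg_of_inner_test hℓ fun φ hφ => ?_)
    have := congrArg conj (huv _ hφ.mem_testGraph)
    rw [map_add, inner_conj_symm, inner_conj_symm, map_zero, add_comm] at this
    exact this

theorem mem_domRestrict_graph {E F : Type*} [AddCommGroup E] [Module ℂ E] [AddCommGroup F]
    [Module ℂ F] {f : E →ₗ.[ℂ] F} {S : Submodule ℂ E} {p : E × F} :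
    p ∈ (f.domRestrict S).graph ↔ p ∈ f.graph ∧ p.1 ∈ S := by
  simp only [LinearPMap.mem_graph_iff]
  constructor
  · rintro ⟨y, h1, h2⟩
    have hy : (y : E) ∈ S ⊓ f.domain := y.2
    refine ⟨⟨⟨y, hy.2⟩, h1, ?_⟩, h1 ▸ hy.1⟩
    rw [← h2]
    exact (LinearPMap.domRestrict_apply rfl).symm
  · rintro ⟨⟨y, h1, h2⟩, hS⟩
    refine ⟨⟨y, ⟨h1 ▸ hS, y.2⟩⟩, h1, ?_⟩
    rw [← h2]
    exact LinearPMap.domRestrict_apply rfl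

theorem mem_delta_graph {ℓ : ℝ} (hℓ : 0 < ℓ) {a b : Sgn} {ξ η : L2 ℓ} :
    (ξ, η) ∈ (delta ℓ a b).graph ↔ IsDelta ℓ a b ξ η := by
  rw [delta, mem_domRestrict_graph, deltaDomain, weakDeriv_graph, Submodule.mem_map]
  constructor
  · rintro ⟨h1, ⟨q, ⟨h2, h3⟩, h4⟩⟩
    obtain ⟨ξ', η'⟩ := q
    change ξ' = ξ at h4
    subst h4
    rw [show η = η' from IsWeakDeriv.unique (s := 1) h1 h2]
    exact (mem_closure_testGraph_iff hℓ).1 h3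
  · intro h
    exact ⟨h.isWeakDeriv hℓ, (ξ, η), ⟨h.isWeakDeriv hℓ, (mem_closure_testGraph_iff hℓ).2 h⟩, rfl⟩

/-- The range of `δ_{ab}`: a free end leaves the integration constant available, while conditions at
both ends require integral zero. -/
theorem exists_isDelta {ℓ : ℝ} (hℓ : 0 < ℓ) {a b : Sgn} (w : L2 ℓ)
    (h : a = .plus → b = .plus → inner ℂ (constL2 ℓ 1) w = 0) :
    ∃ v, IsDelta ℓ a b v w := by
  rw [inner_constL2_left, map_one, one_mul] at h
  cases a
  · obtain ⟨v, g, hg, h0, h1⟩ := exists_isRep hℓ w 0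
    exact ⟨v, g, hg, fun _ => h0, fun hb => by rw [h1, h rfl hb, zero_add]⟩
  · obtain ⟨v, g, hg, h0, h1⟩ := exists_isRep hℓ w (-∫ x in Ioo 0 ℓ, w x)
    exact ⟨v, g, hg, nofun, fun _ => by rw [h1, neg_add_cancel]⟩

theorem isDelta_constL2 (ℓ : ℝ) (c : ℂ) : IsDelta ℓ .minus .minus (constL2 ℓ c) 0 :=
  ⟨_, isRep_constL2 ℓ c, nofun, nofun⟩

theorem isDelta_of_test {ℓ : ℝ} {a b : Sgn} {φ : ℝ → ℂ} (h : IsTestFun (Ioo 0 ℓ) φ) :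
    IsDelta ℓ a b (h.toL2 ℓ) (h.deriv.toL2 ℓ) :=
  (h.mono (Ioo_subset_testInterval ℓ a b)).isDelta (h.coeFn_toL2 ℓ) (h.deriv.coeFn_toL2 ℓ)

/-! ### The operator `D†D` -/

section Hilbert

variable {H : Type*} [NormedAddCommGroup H] [InnerProductSpace ℂ H] [CompleteSpace H]

theorem mem_adjoint_graph_iff {D : H →ₗ.[ℂ] H} (hD : Dense (D.domain : Set H)) {y z : H} :
    (y, z) ∈ D.adjoint.graph ↔ ∀ a b, (a, b) ∈ D.graph → inner ℂ b y = inner ℂ a z := by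
  rw [LinearPMap.adjoint_graph_eq_graph_adjoint hD, Submodule.mem_adjoint_iff]
  simp only [sub_eq_zero]

/-- Orthogonal projection to the graph of a closed operator. -/
theorem exists_mem_graph_orthogonal {D : H →ₗ.[ℂ] H} (hD : D.IsClosed) (u v : H) :
    ∃ x y, (x, y) ∈ D.graph ∧
      ∀ a b, (a, b) ∈ D.graph → inner ℂ a (u - x) + inner ℂ b (v - y) = 0 := by
  set K : Submodule ℂ (WithLp 2 (H × H)) :=
    D.graph.comap (WithLp.linearEquiv 2 ℂ (H × H)).toLinearMap with hK
  have hcl : IsClosed (K : Set (WithLp 2 (H × H))) :=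
    IsClosed.preimage (WithLp.prod_continuous_ofLp 2 H H) hD
  have : CompleteSpace K := hcl.completeSpace_coe
  obtain ⟨k, hk, k', hk', h⟩ := K.exists_add_mem_mem_orthogonal (WithLp.toLp 2 (u, v))
  refine ⟨k.fst, k.snd, hk, fun a b hab => ?_⟩
  have h1 := (Submodule.mem_orthogonal _ _).1 hk' (WithLp.toLp 2 (a, b)) hab
  have hu : u - k.fst = k'.fst := by
    have := congrArg WithLp.fst h
    simp only [WithLp.add_fst] at this
    exact sub_eq_of_eq_add' this
  have hv : v - k.snd = k'.snd := by
    have := congrArg WithLp.snd h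
    simp only [WithLp.add_snd] at this
    exact sub_eq_of_eq_add' this
  rw [hu, hv]
  simpa [WithLp.prod_inner_apply] using h1

-- The hypothesis `hA` expresses `A = D†D` through graphs.
variable {D A : H →ₗ.[ℂ] H} (hDd : Dense (D.domain : Set H)) (hDc : D.IsClosed)
  (hA : ∀ x z, (x, z) ∈ A.graph ↔ ∃ y, (x, y) ∈ D.graph ∧ (y, z) ∈ D.adjoint.graph)

include hDd hDc hA in
-- Surjectivity of `1 + D†D`. Project `(h, 0)` to `(x, Dx)` in the graph of `D`; orthogonality of
-- the residual `(h - x, -Dx)` to the graph says precisely that `D†Dx = h - x`.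
theorem exists_mem_graph_add_eq (h : H) : ∃ x z, (x, z) ∈ A.graph ∧ x + z = h := by
  obtain ⟨x, y, hxy, ho⟩ := exists_mem_graph_orthogonal hDc h 0
  refine ⟨x, h - x, (hA _ _).2 ⟨y, hxy, (mem_adjoint_graph_iff hDd).2 fun a b hab => ?_⟩,
    add_sub_cancel _ _⟩
  have := ho a b hab
  rw [zero_sub, inner_neg_right, add_neg_eq_zero] at this
  exact this.symm

include hDd hA in
theorem inner_eq_inner_of_mem_graph {x y x' z' : H} (h : (x, y) ∈ D.graph)
    (h' : (x', z') ∈ A.graph) : ∃ y', (x', y') ∈ D.graph ∧ inner ℂ x z' = inner ℂ y y' := by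
  obtain ⟨y', h1, h2⟩ := (hA _ _).1 h'
  exact ⟨y', h1, ((mem_adjoint_graph_iff hDd).1 h2 _ _ h).symm⟩

include hA in
theorem domain_le_of_graph : A.domain ≤ D.domain := fun x hx => by
  obtain ⟨y, h, -⟩ := (hA _ _).1 (A.mem_graph ⟨x, hx⟩)
  exact LinearPMap.mem_domain_of_mem_graph h

include hDd in
theorem inner_apply_eq_inner (x : D.domain) (y : A.domain) :
    inner ℂ (x : H) (A y) = inner ℂ (D x) (D ⟨y, domain_le_of_graph hA y.2⟩) := by
  obtain ⟨y', h1, h2⟩ := inner_eq_inner_of_mem_graph hDd hA (D.mem_graph x) (A.mem_graph y)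
  rw [h2, LinearPMap.mem_graph_snd_inj D h1 (D.mem_graph ⟨y, domain_le_of_graph hA y.2⟩) rfl]

include hDd hA in
theorem isFormalAdjoint_self : A.IsFormalAdjoint A := fun x y => by
  have h1 := inner_apply_eq_inner hDd hA ⟨x, domain_le_of_graph hA x.2⟩ y
  have h2 := inner_apply_eq_inner hDd hA ⟨y, domain_le_of_graph hA y.2⟩ x
  change inner ℂ (x : H) (A y) = _ at h1
  change inner ℂ (y : H) (A x) = _ at h2
  rw [h1, ← inner_conj_symm, h2, inner_conj_symm]

include hDd in
theorem inner_self_apply (x : A.domain) :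
    inner ℂ (x : H) (A x) = ((‖D ⟨x, domain_le_of_graph hA x.2⟩‖ ^ 2 : ℝ) : ℂ) := by
  have h1 := inner_apply_eq_inner hDd hA ⟨x, domain_le_of_graph hA x.2⟩ x
  change inner ℂ (x : H) (A x) = _ at h1
  rw [h1, inner_self_eq_norm_sq_to_K]
  push_cast
  rfl

include hDd hDc hA in
theorem eq_zero_of_forall_inner_add {w : H}
    (h : ∀ x z, (x, z) ∈ A.graph → inner ℂ (x + z) w = 0) : w = 0 := by
  obtain ⟨x, z, hxz, hw⟩ := exists_mem_graph_add_eq hDd hDc hA w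
  have := h x z hxz
  rw [hw] at this
  exact inner_self_eq_zero.1 this

include hDd hDc hA in
-- Write a vector orthogonal to the domain as `x + Ax`; pairing it with `x` gives `‖x‖² + ‖Dx‖² =
-- 0`.
theorem dense_domain_of_graph : Dense (A.domain : Set H) := by
  rw [Submodule.dense_iff_topologicalClosure_eq_top, Submodule.topologicalClosure_eq_top_iff,
    eq_bot_iff]
  intro w hw
  obtain ⟨x, z, hxz, rfl⟩ := exists_mem_graph_add_eq hDd hDc hA w
  obtain ⟨y, rfl, rfl⟩ := (LinearPMap.mem_graph_iff A).1 hxz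
  have h0 := (Submodule.mem_orthogonal _ _).1 hw y y.2
  rw [inner_add_right, inner_self_apply hDd hA, inner_self_eq_norm_sq_to_K] at h0
  have h1 : ‖(y : H)‖ ^ 2 + ‖D ⟨y, domain_le_of_graph hA y.2⟩‖ ^ 2 = 0 := by
    have h : ((‖(y : H)‖ ^ 2 + ‖D ⟨y, domain_le_of_graph hA y.2⟩‖ ^ 2 : ℝ) : ℂ) = 0 := by
      rw [← h0]
      push_cast
      rfl
    exact_mod_cast h
  have h2 : ‖(y : H)‖ = 0 := pow_eq_zero_iff two_ne_zero |>.1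
    ((add_eq_zero_iff_of_nonneg (sq_nonneg _) (sq_nonneg _)).1 h1).1
  have h3 : y = 0 := Subtype.ext (norm_eq_zero.1 h2)
  subst h3
  simp

include hDd hDc hA in
/-- von Neumann's theorem: `D†D` is selfadjoint. -/
theorem isSelfAdjoint_of_graph : IsSelfAdjoint A := by
  have hd := dense_domain_of_graph hDd hDc hA
  have hle : A ≤ A.adjoint := (isFormalAdjoint_self hDd hA).le_adjoint hd
  rw [LinearPMap.isSelfAdjoint_def]
  refine le_antisymm (LinearPMap.le_of_le_graph ?_) hle
  rintro ⟨y, w⟩ hyw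
  -- Solve `x + Ax = y + A†y`. Then `y - x` is orthogonal to the range of `1 + A`, which is
  -- everything.
  obtain ⟨x, z, hxz, h⟩ := exists_mem_graph_add_eq hDd hDc hA (y + w)
  have hyx : y - x = 0 := by
    refine eq_zero_of_forall_inner_add hDd hDc hA fun a b hab => ?_
    have h1 := (mem_adjoint_graph_iff hd).1 hyw a b hab
    have h2 := (mem_adjoint_graph_iff hd).1 (LinearPMap.le_graph_of_le hle hxz) a b hab
    rw [inner_sub_right, inner_add_left, inner_add_left, h1, h2, ← inner_add_right,
      ← inner_add_right, h, sub_self]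
  rw [sub_eq_zero] at hyx
  subst hyx
  rw [add_right_inj] at h
  rwa [← h]

include hDd hDc in
/-- The domain of `D†D` is a core of `D`. -/
theorem exists_seq_tendsto_of_mem_graph {x y : H} (hxy : (x, y) ∈ D.graph) :
    ∃ u : ℕ → A.domain, Tendsto (fun n => (u n : H)) atTop (𝓝 x) ∧
      Tendsto (fun n => D ⟨u n, domain_le_of_graph hA (u n).2⟩) atTop (𝓝 y) := by
  have hmem : (x, y) ∈ (D.domRestrict A.domain).graph.topologicalClosure := by
    refine Submodule.mem_topologicalClosure_of_forall_inner _ _ fun u v huv => ?_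
    -- Let `(p, Dp)` be the projection of `(u, v)` to the graph of `D`. It is still orthogonal to
    -- all `(a, Da)` with `a ∈ dom A`, so `⟨a + Aa, p⟩ = 0` and therefore `p = 0`.
    obtain ⟨p, q, hpq, ho⟩ := exists_mem_graph_orthogonal hDc u v
    have hp : p = 0 := by
      refine eq_zero_of_forall_inner_add hDd hDc hA fun a b hab => ?_
      obtain ⟨c, hac, hcb⟩ := (hA _ _).1 hab
      have h1 := huv (a, c) (mem_domRestrict_graph.2
        ⟨hac, LinearPMap.mem_domain_of_mem_graph hab⟩)
      have h2 := ho a c hac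
      have h3 := (mem_adjoint_graph_iff hDd).1 hcb p q hpq
      rw [inner_sub_right, inner_sub_right] at h2
      rw [← inner_conj_symm, ← inner_conj_symm p b, (starRingEnd ℂ).injective.eq_iff] at h3
      rw [inner_add_left, ← h3]
      linear_combination h1 - h2
    subst hp
    have hq : q = 0 := LinearPMap.graph_fst_eq_zero_snd D hpq rfl
    subst hq
    simpa using ho x y hxy
  obtain ⟨s, hs, hlim⟩ := mem_closure_iff_seq_limit.1 hmem
  have hs' := fun n => mem_domRestrict_graph.1 (hs n)
  have h1 : Tendsto (fun n => (s n).1) atTop (𝓝 x) := (continuous_fst.tendsto _).comp hlim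
  have h2 : Tendsto (fun n => (s n).2) atTop (𝓝 y) := (continuous_snd.tendsto _).comp hlim
  refine ⟨fun n => ⟨(s n).1, (hs' n).2⟩, h1, h2.congr fun n => ?_⟩
  obtain ⟨z, hz1, hz2⟩ := (LinearPMap.mem_graph_iff D).1 (hs' n).1
  rw [← hz2]
  congr 1
  exact Subtype.ext hz1

end Hilbert

/-! ### The Friedrichs extension -/

section Friedrichs

variable {ℓ : ℝ} {D A : L2 ℓ →ₗ.[ℂ] L2 ℓ} (hDd : Dense (D.domain : Set (L2 ℓ)))
  (hDc : D.IsClosed)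
  (hA : ∀ x z, (x, z) ∈ A.graph ↔ ∃ y, (x, y) ∈ D.graph ∧ (y, z) ∈ D.adjoint.graph)

include hDd hDc in
-- Since `⟨w, Aw⟩ = ‖Dw‖²`, the Cauchy condition for the form says that `D (u n)` is Cauchy;
-- closedness of `D` identifies its limit.
theorem formConverges_iff {u : ℕ → A.domain} {ξ : L2 ℓ} :
    FormConverges A u ξ ↔ ∃ η, (ξ, η) ∈ D.graph ∧ Tendsto (fun n => (u n : L2 ℓ)) atTop (𝓝 ξ) ∧
      Tendsto (fun n => D ⟨u n, domain_le_of_graph hA (u n).2⟩) atTop (𝓝 η) := by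
  set d : ℕ → L2 ℓ := fun n => D ⟨u n, domain_le_of_graph hA (u n).2⟩ with hd
  have hkey : ∀ p : ℕ × ℕ, inner ℂ ((u p.1 - u p.2 : A.domain) : L2 ℓ) (A (u p.1 - u p.2)) =
      ((dist (d p.1) (d p.2) ^ 2 : ℝ) : ℂ) := by
    intro p
    rw [inner_self_apply hDd hA, dist_eq_norm, hd, ← LinearPMap.map_sub]
    rfl
  have hcauchy : Tendsto (fun p : ℕ × ℕ =>
      inner ℂ ((u p.1 - u p.2 : A.domain) : L2 ℓ) (A (u p.1 - u p.2))) atTop (𝓝 0) ↔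
      CauchySeq d := by
    rw [cauchySeq_iff_tendsto_dist_atTop_0]
    simp only [hkey]
    constructor
    · intro h
      have h1 := (Complex.continuous_re.tendsto 0).comp h
      have h2 := (Real.continuous_sqrt.tendsto _).comp h1
      simpa [Function.comp_def, Real.sqrt_sq dist_nonneg, -Complex.ofReal_pow] using h2
    · intro h
      have h1 := (Complex.continuous_ofReal.tendsto _).comp (h.pow 2)
      simpa [Function.comp_def] using h1
  rw [FormConverges, hcauchy]
  constructor
  · rintro ⟨h1, h2⟩
    obtain ⟨η, hη⟩ := cauchySeq_tendsto_of_complete h2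
    exact ⟨η, hDc.mem_of_tendsto (h1.prodMk_nhds hη) (Eventually.of_forall fun n =>
      D.mem_graph ⟨u n, domain_le_of_graph hA (u n).2⟩), h1, hη⟩
  · rintro ⟨η, -, h1, h2⟩
    exact ⟨h1, h2.cauchySeq⟩

include hDd hDc hA in
theorem mem_formClosureDomain_iff {ξ : L2 ℓ} :
    ξ ∈ formClosureDomain A ↔ ∃ η, (ξ, η) ∈ D.graph := by
  constructor
  · rintro ⟨u, hu⟩
    obtain ⟨η, h, -⟩ := (formConverges_iff hDd hDc hA).1 hu
    exact ⟨η, h⟩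
  · rintro ⟨η, h⟩
    obtain ⟨u, h1, h2⟩ := exists_seq_tendsto_of_mem_graph hDd hDc hA h
    exact ⟨u, (formConverges_iff hDd hDc hA).2 ⟨η, h, h1, h2⟩⟩

include hDd hDc hA in
-- The value does not depend on the approximating sequences; their existence is the core property.
theorem formClosureValue_iff {ξ η u v : L2 ℓ} (hξ : (ξ, u) ∈ D.graph) (hη : (η, v) ∈ D.graph)
    {c : ℂ} : FormClosureValue A ξ η c ↔ c = inner ℂ u v := by
  have hlim : ∀ s t : ℕ → A.domain,
      Tendsto (fun n => D ⟨s n, domain_le_of_graph hA (s n).2⟩) atTop (𝓝 u) →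
      Tendsto (fun n => D ⟨t n, domain_le_of_graph hA (t n).2⟩) atTop (𝓝 v) →
      Tendsto (fun n => inner ℂ (s n : L2 ℓ) (A (t n))) atTop (𝓝 (inner ℂ u v)) := by
    intro s t hs ht
    refine (hs.inner ht).congr fun n => ?_
    exact (inner_apply_eq_inner hDd hA ⟨s n, domain_le_of_graph hA (s n).2⟩ (t n)).symm
  constructor
  · rintro ⟨s, t, hs, ht, hc⟩
    obtain ⟨u', hu', -, hs'⟩ := (formConverges_iff hDd hDc hA).1 hs
    obtain ⟨v', hv', -, ht'⟩ := (formConverges_iff hDd hDc hA).1 ht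
    rw [LinearPMap.mem_graph_snd_inj D hu' hξ rfl] at hs'
    rw [LinearPMap.mem_graph_snd_inj D hv' hη rfl] at ht'
    exact tendsto_nhds_unique hc (hlim s t hs' ht')
  · rintro rfl
    obtain ⟨s, hs1, hs2⟩ := exists_seq_tendsto_of_mem_graph hDd hDc hA hξ
    obtain ⟨t, ht1, ht2⟩ := exists_seq_tendsto_of_mem_graph hDd hDc hA hη
    exact ⟨s, t, (formConverges_iff hDd hDc hA).2 ⟨u, hξ, hs1, hs2⟩,
      (formConverges_iff hDd hDc hA).2 ⟨v, hη, ht1, ht2⟩, hlim s t hs2 ht2⟩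

include hDd hA in
theorem isPositiveOp_of_graph : IsPositiveOp A := fun ξ => by
  rw [inner_self_apply hDd hA]
  exact ⟨by rw [Complex.ofReal_re]; positivity, Complex.ofReal_im _⟩

include hDd hDc hA in
-- For the closed form `⟨Dξ, Dη⟩`, the defining condition of the associated operator is the
-- definition of `Dη ∈ dom D†` with `D†Dη = φ`.
theorem isFriedrichsExtension_self : IsFriedrichsExtension A A where
  dense := dense_domain_of_graph hDd hDc hA
  symmetric := isFormalAdjoint_self hDd hA
  positive := isPositiveOp_of_graph hDd hA
  graph_iff η φ := by
    rw [hA, mem_formClosureDomain_iff hDd hDc hA]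
    constructor
    · rintro ⟨v, h1, h2⟩
      refine ⟨⟨v, h1⟩, fun ξ hξ => ?_⟩
      obtain ⟨u, hu⟩ := (mem_formClosureDomain_iff hDd hDc hA).1 hξ
      exact (formClosureValue_iff hDd hDc hA hu h1).2
        ((mem_adjoint_graph_iff hDd).1 h2 _ _ hu).symm
    · rintro ⟨⟨v, h1⟩, h⟩
      refine ⟨v, h1, (mem_adjoint_graph_iff hDd).2 fun a b hab => ?_⟩
      exact ((formClosureValue_iff hDd hDc hA hab h1).1
        (h a ((mem_formClosureDomain_iff hDd hDc hA).2 ⟨b, hab⟩))).symm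

end Friedrichs

/-! ### Products of two first-order operators -/

theorem mem_opMul_delta_graph {ℓ : ℝ} (hℓ : 0 < ℓ) {a b c d : Sgn} {ξ ζ : L2 ℓ} :
    (ξ, ζ) ∈ (opMul (delta ℓ c d) (delta ℓ a b)).graph ↔
      ∃ η, IsDelta ℓ a b ξ η ∧ IsDelta ℓ c d η ζ := by
  simp only [mem_opMul_graph, mem_delta_graph hℓ]

theorem dense_opMul_delta_domain {ℓ : ℝ} (hℓ : 0 < ℓ) (a b c d : Sgn) :
    Dense ((opMul (delta ℓ c d) (delta ℓ a b)).domain : Set (L2 ℓ)) := by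
  rw [Submodule.dense_iff_topologicalClosure_eq_top, Submodule.topologicalClosure_eq_top_iff,
    eq_bot_iff]
  intro η hη
  refine eq_zero_of_inner_test fun φ hφ => ?_
  exact (Submodule.mem_orthogonal' _ _).1 hη _ (LinearPMap.mem_domain_of_mem_graph
    ((mem_opMul_delta_graph hℓ).2 ⟨_, isDelta_of_test hφ, isDelta_of_test hφ.deriv⟩))

theorem isDelta_zero {ℓ : ℝ} (hℓ : 0 < ℓ) (a b : Sgn) : IsDelta ℓ a b 0 0 :=
  (mem_delta_graph hℓ).1 (delta ℓ a b).graph.zero_mem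

theorem IsDelta.sub_smul {ℓ : ℝ} (hℓ : 0 < ℓ) {a b : Sgn} {ξ η u v : L2 ℓ}
    (h : IsDelta ℓ a b ξ η) (h' : IsDelta ℓ a b u v) (k : ℂ) :
    IsDelta ℓ a b (ξ - k • u) (η - k • v) :=
  (mem_delta_graph hℓ).1 ((delta ℓ a b).graph.sub_mem ((mem_delta_graph hℓ).2 h)
    ((delta ℓ a b).graph.smul_mem k ((mem_delta_graph hℓ).2 h')))

/-- An element of the adjoint of `δ_{cd} δ_{ab}` factors through the adjoint of `δ_{ab}`. -/
theorem exists_isDelta_of_forall_inner {ℓ : ℝ} (hℓ : 0 < ℓ) {a b c d : Sgn} {u w : L2 ℓ}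
    (h : ∀ ξ η ζ, IsDelta ℓ a b ξ η → IsDelta ℓ c d η ζ → inner ℂ ζ u = inner ℂ ξ w) :
    ∃ v, IsDelta ℓ a.neg b.neg v w ∧
      ∀ η ζ, IsDelta ℓ c d η ζ → inner ℂ ζ u + inner ℂ η v = 0 := by
  -- A primitive `v` of `w` is obstructed only if it must vanish at both ends. Then constants lie in
  -- the kernel of `δ_{ab}`, and `h` for the constant one gives the required vanishing integral.
  obtain ⟨v, hv⟩ : ∃ v, IsDelta ℓ a.neg b.neg v w := by
    refine exists_isDelta hℓ w fun ha hb => ?_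
    have ha' : a = .minus := by cases a <;> simp_all [Sgn.neg]
    have hb' : b = .minus := by cases b <;> simp_all [Sgn.neg]
    subst ha' hb'
    rw [← h _ _ _ (isDelta_constL2 ℓ 1) (isDelta_zero hℓ c d), inner_zero_left]
  have hrange : ∀ η ζ, (a = .plus → b = .plus → inner ℂ (constL2 ℓ 1) η = 0) →
      IsDelta ℓ c d η ζ → inner ℂ ζ u + inner ℂ η v = 0 := by
    intro η ζ hη hηζ
    obtain ⟨ξ, hξ⟩ := exists_isDelta hℓ η hη
    rw [h ξ η ζ hξ hηζ]
    exact hξ.inner_add_inner hℓ hv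
  -- In this case `hrange` covers only `η` of integral zero, but `v` carries no boundary conditions
  -- and may be shifted by a constant. The shift `k` makes the identity hold for one `e` of nonzero
  -- integral; subtracting a multiple of `e` reduces every `η` to integral zero.
  by_cases hab : a = .plus ∧ b = .plus
  · obtain ⟨rfl, rfl⟩ := hab
    obtain ⟨ψ, hψ, hm⟩ := exists_isTestFun_integral_ne_zero hℓ
    set e := hψ.toL2 ℓ
    set e' := hψ.deriv.toL2 ℓ
    have he : inner ℂ (constL2 ℓ 1) e ≠ 0 := by
      rw [inner_constL2_left, map_one, one_mul, integral_congr_ae (hψ.coeFn_toL2 ℓ)]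
      exact hm
    have he' : inner ℂ e (constL2 ℓ 1) ≠ 0 := by
      rwa [← inner_conj_symm, Ne, map_eq_zero]
    set k := (inner ℂ e' u + inner ℂ e v) / inner ℂ e (constL2 ℓ 1) with hk
    refine ⟨v - k • constL2 ℓ 1, ?_, fun η ζ hηζ => ?_⟩
    · have := hv.sub_smul hℓ (isDelta_constL2 ℓ 1) k
      rwa [smul_zero, sub_zero] at this
    · have h1 := hrange _ _ (fun _ _ => ?_) (hηζ.sub_smul hℓ (isDelta_of_test hψ)
        (inner ℂ (constL2 ℓ 1) η / inner ℂ (constL2 ℓ 1) e))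
      · rw [inner_sub_left, inner_sub_left, inner_smul_left, inner_smul_left, map_div₀,
          inner_conj_symm, inner_conj_symm] at h1
        have hk' : inner ℂ e' u + inner ℂ e v = k * inner ℂ e (constL2 ℓ 1) :=
          (div_mul_cancel₀ _ he').symm
        have h2 : inner ℂ η (constL2 ℓ 1) / inner ℂ e (constL2 ℓ 1) *
            inner ℂ e (constL2 ℓ 1) = inner ℂ η (constL2 ℓ 1) := div_mul_cancel₀ _ he'
        rw [inner_sub_right, inner_smul_right]
        linear_combination h1 + inner ℂ η (constL2 ℓ 1) / inner ℂ e (constL2 ℓ 1) * hk' + k * h2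
      · rw [inner_sub_right, inner_smul_right, div_mul_cancel₀ _ he, sub_self]
  · exact ⟨v, hv, fun η ζ => hrange η ζ fun ha hb => absurd ⟨ha, hb⟩ hab⟩

/-- Each factor contributes a minus sign, and the two cancel. The nontrivial inclusion is that every
element of the adjoint factors through an intermediate `v`; testing against functions for the signs
`c`, `d` then puts `u` in the domain of the first factor. -/
theorem opMul_delta_adjoint {ℓ : ℝ} (hℓ : 0 < ℓ) (a b c d : Sgn) :
    (opMul (delta ℓ c d) (delta ℓ a b)).adjoint =
      opMul (delta ℓ a.neg b.neg) (delta ℓ c.neg d.neg) := by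
  refine LinearPMap.eq_of_eq_graph (Submodule.ext ?_)
  rintro ⟨u, w⟩
  rw [mem_adjoint_graph_iff (dense_opMul_delta_domain hℓ a b c d), mem_opMul_delta_graph hℓ]
  constructor
  · intro h
    obtain ⟨v, hv, hz⟩ := exists_isDelta_of_forall_inner hℓ fun ξ η ζ h1 h2 =>
      h ξ ζ ((mem_opMul_delta_graph hℓ).2 ⟨η, h1, h2⟩)
    refine ⟨v, isDelta_neg_of_inner_test hℓ fun φ hφ => ?_, hv⟩
    have := congrArg conj (hz _ _ (hφ.isDelta (hφ.coeFn_toL2 ℓ) (hφ.deriv.coeFn_toL2 ℓ)))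
    rwa [map_add, inner_conj_symm, inner_conj_symm, map_zero] at this
  · rintro ⟨v, huv, hvw⟩ ξ ζ h
    obtain ⟨η, h1, h2⟩ := (mem_opMul_delta_graph hℓ).1 h
    linear_combination h2.inner_add_inner hℓ huv - h1.inner_add_inner hℓ hvw

/-- The product is itself the adjoint of a product of the same kind. -/
theorem opMul_delta_isClosed {ℓ : ℝ} (hℓ : 0 < ℓ) (a b c d : Sgn) :
    (opMul (delta ℓ c d) (delta ℓ a b)).IsClosed := by
  have h := opMul_delta_adjoint hℓ c.neg d.neg a.neg b.neg
  simp only [Sgn.neg_neg] at h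
  rw [← h]
  exact LinearPMap.adjoint_isClosed (dense_opMul_delta_domain hℓ _ _ _ _)

/-! ### Higher weak derivatives -/

theorem isWeakDeriv_zero_self (ℓ : ℝ) (ξ : L2 ℓ) : IsWeakDeriv ℓ 0 ξ ξ := fun φ _ => by simp

theorem IsWeakDeriv.succ_iff {ℓ : ℝ} {s : ℕ} {ξ η ζ : L2 ℓ} (h : IsWeakDeriv ℓ s ξ η) :
    IsWeakDeriv ℓ (s + 1) ξ ζ ↔ IsWeakDeriv ℓ 1 η ζ := by
  refine forall_congr' fun φ => forall_congr' fun hφ => ?_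
  rw [iteratedDeriv_one, h _ hφ.deriv, iteratedDeriv_succ', pow_one, pow_succ, neg_one_mul,
    mul_neg_one, neg_mul]

theorem isDelta_iff_vanishesAt {ℓ : ℝ} (hℓ : 0 < ℓ) {k : ℕ} {s : End → Sgn} {ξ η ζ : L2 ℓ}
    (h : IsWeakDeriv ℓ k ξ η) : IsDelta ℓ (s .left) (s .right) η ζ ↔
      IsWeakDeriv ℓ 1 η ζ ∧ ∀ e, s e = .plus → VanishesAt ℓ k e ξ := by
  constructor
  · rintro ⟨g, hg, h0, h1⟩
    refine ⟨hg.isWeakDeriv hℓ, fun e he => (vanishesAt_iff hℓ h hg).2 ?_⟩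
    cases e
    · exact h0 he
    · exact h1 he
  · rintro ⟨hd, hv⟩
    obtain ⟨g, hg⟩ := hd.exists_isRep hℓ
    exact ⟨g, hg, fun he => (vanishesAt_iff hℓ h hg).1 (hv _ he),
      fun he => (vanishesAt_iff hℓ h hg).1 (hv _ he)⟩

/-! ### The nine supports -/

/-- The boundary conditions imposed on `ξ`. -/
def Support.sgnZero : Support → End → Sgn
  | .aa, _ => .plus
  | .ab, _ => .plus
  | .ac, .left => .plus
  | .ac, .right => .minus
  | .bb, _ => .plus
  | .bc, .left => .plus
  | .bc, .right => .minus
  | .cc, _ => .minus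
  | .add1, _ => .minus
  | .add2, .left => .plus
  | .add2, .right => .minus
  | .add3, .left => .minus
  | .add3, .right => .plus

/-- The boundary conditions imposed on `ξ'`. -/
def Support.sgnOne : Support → End → Sgn
  | .aa, _ => .minus
  | .ab, .left => .minus
  | .ab, .right => .plus
  | .ac, _ => .minus
  | .bb, _ => .plus
  | .bc, .left => .plus
  | .bc, .right => .minus
  | .cc, _ => .minus
  | .add1, _ => .plus
  | .add2, .left => .minus
  | .add2, .right => .plus
  | .add3, .left => .plus
  | .add3, .right => .minus

theorem innerOp_eq (ℓ : ℝ) (S : Support) :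
    innerOp ℓ S = opMul (delta ℓ (S.sgnOne .left) (S.sgnOne .right))
      (delta ℓ (S.sgnZero .left) (S.sgnZero .right)) := by
  cases S <;> rfl

/-- The structural coincidence behind all nine cases: the left half reverses the order of the
factors and complements their signs, as taking the adjoint does. -/
theorem outerOp_eq (ℓ : ℝ) (S : Support) :
    outerOp ℓ S = opMul (delta ℓ (S.sgnZero .left).neg (S.sgnZero .right).neg)
      (delta ℓ (S.sgnOne .left).neg (S.sgnOne .right).neg) := by
  cases S <;> rfl

/-- The same duality for boundary conditions: at each end exactly one of `ξ`, `ξ'''` and exactly one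
of `ξ'`, `ξ''` is prescribed. -/
theorem mem_bv_iff (S : Support) (p : ℕ × End) :
    p ∈ S.bv ↔ (p.1 = 0 ∧ S.sgnZero p.2 = .plus) ∨ (p.1 = 1 ∧ S.sgnOne p.2 = .plus) ∨
      (p.1 = 2 ∧ (S.sgnOne p.2).neg = .plus) ∨ (p.1 = 3 ∧ (S.sgnZero p.2).neg = .plus) := by
  obtain ⟨k, e⟩ := p
  cases S <;> cases e <;> simp [Support.bv, Support.sgnZero, Support.sgnOne, Sgn.neg]

theorem innerOp_dense {ℓ : ℝ} (hℓ : 0 < ℓ) (S : Support) :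
    Dense ((innerOp ℓ S).domain : Set (L2 ℓ)) := by
  rw [innerOp_eq]
  exact dense_opMul_delta_domain hℓ _ _ _ _

theorem innerOp_isClosed {ℓ : ℝ} (hℓ : 0 < ℓ) (S : Support) : (innerOp ℓ S).IsClosed := by
  rw [innerOp_eq]
  exact opMul_delta_isClosed hℓ _ _ _ _

theorem innerOp_adjoint {ℓ : ℝ} (hℓ : 0 < ℓ) (S : Support) :
    (innerOp ℓ S).adjoint = outerOp ℓ S := by
  rw [innerOp_eq, outerOp_eq, opMul_delta_adjoint hℓ]

theorem mem_productOp_graph {ℓ : ℝ} (hℓ : 0 < ℓ) (S : Support) (ξ ζ : L2 ℓ) :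
    (ξ, ζ) ∈ (productOp ℓ S).graph ↔
      ∃ η, (ξ, η) ∈ (innerOp ℓ S).graph ∧ (η, ζ) ∈ (innerOp ℓ S).adjoint.graph := by
  rw [innerOp_adjoint hℓ]
  exact mem_opMul_graph _ _ _ _

/-- The intermediate vectors of the fourfold product are the successive weak derivatives of `ξ`, and
the factor acting on the `k`-th derivative encodes the conditions of order `k`. -/
theorem mem_productOp_graph_iff {ℓ : ℝ} (hℓ : 0 < ℓ) (S : Support) (ξ ζ : L2 ℓ) :
    (ξ, ζ) ∈ (productOp ℓ S).graph ↔ ξ ∈ sobolev ℓ 4 ∧ FulfillsAllBV ℓ S ξ ∧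
      IsWeakDeriv ℓ 4 ξ ζ := by
  rw [productOp, mem_opMul_graph, innerOp_eq, outerOp_eq]
  simp only [mem_opMul_delta_graph hℓ]
  constructor
  · rintro ⟨ξ₂, ⟨ξ₁, h0, h1⟩, ⟨ξ₃, h2, h3⟩⟩
    have w0 := isWeakDeriv_zero_self ℓ ξ
    have v0 := (isDelta_iff_vanishesAt hℓ w0).1 h0
    have v1 := (isDelta_iff_vanishesAt hℓ v0.1).1 h1
    have w2 := v0.1.succ_iff.2 v1.1
    have v2 := (isDelta_iff_vanishesAt (s := fun e => (S.sgnOne e).neg) hℓ w2).1 h2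
    have w3 := w2.succ_iff.2 v2.1
    have v3 := (isDelta_iff_vanishesAt (s := fun e => (S.sgnZero e).neg) hℓ w3).1 h3
    have w4 := w3.succ_iff.2 v3.1
    refine ⟨fun s hs => ?_, fun p hp => ?_, w4⟩
    · interval_cases s
      exacts [⟨_, w0⟩, ⟨_, v0.1⟩, ⟨_, w2⟩, ⟨_, w3⟩, ⟨_, w4⟩]
    · rcases (mem_bv_iff S p).1 hp with ⟨e, h⟩ | ⟨e, h⟩ | ⟨e, h⟩ | ⟨e, h⟩ <;> rw [e]
      exacts [v0.2 _ h, v1.2 _ h, v2.2 _ h, v3.2 _ h]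
  · rintro ⟨hs, hbv, w4⟩
    have w0 := isWeakDeriv_zero_self ℓ ξ
    obtain ⟨ξ₁, w1⟩ := hs 1 (by norm_num)
    obtain ⟨ξ₂, w2⟩ := hs 2 (by norm_num)
    obtain ⟨ξ₃, w3⟩ := hs 3 (by norm_num)
    refine ⟨ξ₂, ⟨ξ₁, ?_, ?_⟩, ⟨ξ₃, ?_, ?_⟩⟩
    · exact (isDelta_iff_vanishesAt hℓ w0).2 ⟨w1, fun e he =>
        hbv (0, e) ((mem_bv_iff S _).2 (Or.inl ⟨rfl, he⟩))⟩
    · exact (isDelta_iff_vanishesAt hℓ w1).2 ⟨w1.succ_iff.1 w2, fun e he =>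
        hbv (1, e) ((mem_bv_iff S _).2 (Or.inr (Or.inl ⟨rfl, he⟩)))⟩
    · exact (isDelta_iff_vanishesAt (s := fun e => (S.sgnOne e).neg) hℓ w2).2
        ⟨w2.succ_iff.1 w3, fun e he =>
          hbv (2, e) ((mem_bv_iff S _).2 (Or.inr (Or.inr (Or.inl ⟨rfl, he⟩))))⟩
    · exact (isDelta_iff_vanishesAt (s := fun e => (S.sgnZero e).neg) hℓ w3).2
        ⟨w3.succ_iff.1 w4, fun e he =>
          hbv (3, e) ((mem_bv_iff S _).2 (Or.inr (Or.inr (Or.inr ⟨rfl, he⟩))))⟩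

theorem productOp_domain_eq {ℓ : ℝ} (hℓ : 0 < ℓ) (S : Support) :
    {ξ | ξ ∈ sobolev ℓ 4 ∧ FulfillsAllBV ℓ S ξ} = ((productOp ℓ S).domain : Set (L2 ℓ)) := by
  ext ξ
  rw [mem_ofPred_eq, SetLike.mem_coe, LinearPMap.mem_domain_iff]
  simp only [mem_productOp_graph_iff hℓ]
  constructor
  · rintro ⟨h1, h2⟩
    obtain ⟨ζ, h⟩ := h1 4 le_rfl
    exact ⟨ζ, h1, h2, h⟩
  · rintro ⟨ζ, h1, h2, -⟩
    exact ⟨h1, h2⟩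

/-- Taking adjoints reverses inclusions, so `A ≤ B` also gives `B = B† ≤ A† = A`. -/
theorem eq_of_isSelfAdjoint_of_le {H : Type*} [NormedAddCommGroup H] [InnerProductSpace ℂ H]
    [CompleteSpace H] {A B : H →ₗ.[ℂ] H} (hA : IsSelfAdjoint A) (hB : IsSelfAdjoint B)
    (h : A ≤ B) : B = A := by
  refine le_antisymm (LinearPMap.le_of_le_graph ?_) h
  rintro ⟨y, w⟩ hyw
  rw [← LinearPMap.isSelfAdjoint_def.1 hA, mem_adjoint_graph_iff hA.dense_domain]
  rw [← LinearPMap.isSelfAdjoint_def.1 hB, mem_adjoint_graph_iff hB.dense_domain] at hyw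
  exact fun a b hab => hyw a b (LinearPMap.le_graph_of_le h hab)

theorem isAdmissibleExtension_productOp {ℓ : ℝ} (hℓ : 0 < ℓ) (S : Support) :
    IsAdmissibleExtension ℓ S (productOp ℓ S) where
  selfAdjoint := isSelfAdjoint_of_graph (innerOp_dense hℓ S) (innerOp_isClosed hℓ S)
    (mem_productOp_graph hℓ S)
  positive := isPositiveOp_of_graph (innerOp_dense hℓ S) (mem_productOp_graph hℓ S)
  extends_product := le_rfl
  domain_subset ξ hξ := by
    have h : ξ ∈ {ξ | ξ ∈ sobolev ℓ 4 ∧ FulfillsAllBV ℓ S ξ} := by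
      rw [productOp_domain_eq hℓ]
      exact hξ
    exact ⟨fun s hs => h.1 s (hs.trans (by norm_num)), fun p hp _ => h.2 p hp⟩

end Beam

end

theorem mainTheorem1 (ℓ : ℝ) (hℓ : 0 < ℓ) (S : Beam.Support) :
    ∃ A : Beam.L2 ℓ →ₗ.[ℂ] Beam.L2 ℓ,
      (Beam.IsAdmissibleExtension ℓ S A ∧ ∀ B, Beam.IsAdmissibleExtension ℓ S B → B = A) ∧
      Beam.IsFriedrichsExtension (Beam.productOp ℓ S) A ∧
      A = Beam.opMul (Beam.innerOp ℓ S).adjoint (Beam.innerOp ℓ S) ∧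
      (∀ ξ : A.domain, (ξ : Beam.L2 ℓ) ∈ Beam.sobolev ℓ 4 →
        Beam.IsWeakDeriv ℓ 4 (ξ : Beam.L2 ℓ) (A ξ)) ∧
      (A.domain : Set (Beam.L2 ℓ)) ∩ (Beam.sobolev ℓ 4 : Set (Beam.L2 ℓ)) =
        {ξ | ξ ∈ Beam.sobolev ℓ 4 ∧ Beam.FulfillsAllBV ℓ S ξ} ∧
      {ξ | ξ ∈ Beam.sobolev ℓ 4 ∧ Beam.FulfillsAllBV ℓ S ξ} =
        ((Beam.productOp ℓ S).domain : Set (Beam.L2 ℓ)) := by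
  have hadm := Beam.isAdmissibleExtension_productOp hℓ S
  have hdom := Beam.productOp_domain_eq hℓ S
  refine ⟨Beam.productOp ℓ S, ⟨hadm, fun B hB =>
    Beam.eq_of_isSelfAdjoint_of_le hadm.selfAdjoint hB.selfAdjoint hB.extends_product⟩,
    Beam.isFriedrichsExtension_self (Beam.innerOp_dense hℓ S) (Beam.innerOp_isClosed hℓ S)
      (Beam.mem_productOp_graph hℓ S), ?_, fun ξ _ => ?_, ?_, hdom⟩
  · rw [Beam.innerOp_adjoint hℓ, Beam.productOp]
  · exact ((Beam.mem_productOp_graph_iff hℓ S _ _).1 (LinearPMap.mem_graph _ ξ)).2.2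
  · rw [← hdom]
    exact inter_eq_left.2 fun ξ h => h.1
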